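/- **Setting.** A strict partition is a sequence $\lambda=(\lambda_1>\lambda_2>\dots>\lambda_{\ell(\lambda)}>0)$ of positive integers (possibly empty); $|\lambda|=\sum_i\lambda_i$ is its weight and $\ell(\lambda)$ its length. It is identified with its shifted Young diagram, whose $i$-th row consists of the boxes $(i,j)$, $i\le j\le i+\lambda_i-1$; the content of a box $\square=(i,j)$ is $\mathrm c(\square)=j-i$. Let $\mathbb S$ be the set of all strict partitions and $\mathbb S_n=\{\lambda\in\mathbb S:|\lambda|=n\}$. Write $\mu\nearrow\lambda$ if $\lambda$ is obtained from $\mu$ by adding one box $\lambda/\mu$. Put $\kappa(\mu,\lambda)=2$ if $\mu\nearrow\lambda$ and $\ell(\lambda)=\ell(\mu)$, $\kappa(\mu,\lambda)=1$ if $\mu\nearrow\lambda$ and $\ell(\lambda)=\ell(\mu)+1$, and $\kappa(\mu,\lambda)=0$ otherwise. The Schur graph has vertex set $\mathbb S$ and $\kappa(\mu,\lambda)$ edges from $\mu$ to $\lambda$, and $\mathsf h(\lambda)$ denotes the number of oriented paths in it from $\varnothing$ to $\lambda$. Let $Y(\mu)=\{\mathrm c(\mu/\varkappa):\varkappa\nearrow\mu\}$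 be the set of contents of the boxes that can be removed from $\mu$ (so $Y(\varnothing)=\varnothing$), and for $y\in Y(\mu)$ let $\mu-\square(y)$ be the unique $\varkappa\nearrow\mu$ with $\mathrm c(\mu/\varkappa)=y$. Fix $\alpha\in(0,+\infty)$. For $\lambda\in\mathbb S_n$ put $$M_n^\alpha(\lambda)=\frac{\mathsf h(\lambda)^2}{n!}\,2^{\ell(\lambda)-n}\cdot\frac{\prod_{\square\in\lambda}\big(\mathrm c(\square)(\mathrm c(\square)+1)+\alpha\big)}{\alpha(\alpha+2)\cdots(\alpha+2n-2)}.$$ For $\lambda\in\mathbb S_n$, $\nu\in\mathbb S_{n+1}$ put $$p^\downarrow(\nu,\lambda)=\frac{\mathsf h(\lambda)}{\mathsf h(\nu)}\,\kappa(\lambda,\nu),\qquad p^\uparrow_\alpha(\lambda,\nu)=\frac{M_{n+1}^\alpha(\nu)}{M_n^\alpha(\lambda)}\,p^\downarrow(\nu,\lambda).$$ The $n$-th up/down transition operator $T_n$ acts on real-valued functions $f$ on $\mathbb S_n$ by $$(T_nf)(\lambda)=\sum_{\widetilde\lambda\in\mathbb S_n}\ \sum_{\nu\in\mathbb S_{n+1}}p^\uparrow_\alpha(\lambda,\nu)\,p^\downarrow(\nu,\widetilde\lambda)\,f(\widetilde\lambda).$$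 For $\mu\in\mathbb S$ the factorial Schur $\mathcal Q$-function $\mathcal Q^*_\mu$ is given, for $N\ge\ell(\mu)$, by $$\mathcal Q^*_\mu(y_1,\dots,y_N,0,0,\dots)=\frac{2^{\ell(\mu)}}{(N-\ell(\mu))!}\sum_{w\in\mathfrak S_N}\ \prod_{i\le\ell(\mu)}y_{w(i)}^{\downarrow\mu_i}\prod_{\substack{i\le\ell(\mu)\\ i<j\le N}}\frac{y_{w(i)}+y_{w(j)}}{y_{w(i)}-y_{w(j)}},$$ where $a^{\downarrow k}=a(a-1)\cdots(a-k+1)$, and by $\mathcal Q^*_\mu(y_1,\dots,y_N,0,0,\dots)=0$ for $N<\ell(\mu)$. It is regarded as a function on $\mathbb S$ through $\mathcal Q^*_\mu(\lambda)=\mathcal Q^*_\mu(\lambda_1,\dots,\lambda_{\ell(\lambda)},0,0,\dots)$, and $(\mathcal Q^*_\mu)_n$ denotes its restriction to $\mathbb S_n$. **Theorem 2.7.** For every $\alpha\in(0,+\infty)$, every integer $n\ge1$ and every $\mu\in\mathbb S$, $$(T_n-\mathbf 1)(\mathcal Q^*_\mu)_n=\frac{1}{(n+1)(n+\alpha/2)}\Big[-|\mu|\big(|\mu|+\tfrac{\alpha}{2}-1\big)(\mathcal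 Q^*_\mu)_n+(n-|\mu|+1)\sum_{y\in Y(\mu)}\big(y(y+1)+\alpha\big)(\mathcal Q^*_{\mu-\square(y)})_n\Big],$$ where $\mathbf 1$ is the identity operator. -/

import Mathlib

/-- A strict partition `l = (l_1 > l_2 > ... > l_r > 0)`, given by the list of its nonzero parts.
It is identified with its shifted Young diagram, see `StrictPartition.boxes`. -/
@[ext]
structure StrictPartition where
  parts : List ℕ
  strict : parts.Pairwise (fun a b => b < a)
  pos : ∀ k ∈ parts, 0 < k

namespace StrictPartition

/-- The empty partition. -/
def empty : StrictPartition := ⟨[], List.Pairwise.nil, by simp⟩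

/-- The length `ℓ(l)`: the number of nonzero parts. -/
def length (l : StrictPartition) : ℕ := l.parts.length

/-- The weight `|l|`: the sum of the parts. -/
def weight (l : StrictPartition) : ℕ := l.parts.sum

/-- The `i`-th part, with `i` counted from `0`; it is `0` for `i ≥ ℓ(l)`. -/
def part (l : StrictPartition) (i : ℕ) : ℕ := l.parts.getD i 0

/-- The boxes `(i, j)` (row, column) of the shifted Young diagram of `l`: row `i` consists of `l_i`
boxes and starts at the diagonal box `(i, i)`. Rows and columns are counted from `0`; only the
differences `j - i` are used below, and they do not depend on where the counting starts. -/
def boxes (l : StrictPartition) : Finset (ℕ × ℕ) :=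
  (Finset.range l.length).biUnion fun i =>
    (Finset.Ico i (i + l.part i)).image fun j => (i, j)

/-- The content `j - i` of the box in row `i` and column `j`. -/
def content (b : ℕ × ℕ) : ℤ := (b.2 : ℤ) - (b.1 : ℤ)

/-- The shifted diagram `l` is obtained from the shifted diagram `m` by adding the box `b`. -/
def AddBox (m : StrictPartition) (b : ℕ × ℕ) (l : StrictPartition) : Prop :=
  b ∉ m.boxes ∧ l.boxes = insert b m.boxes

/-- `m ↗ l`: the shifted diagram `l` is obtained from `m` by adding one box. -/
def Covers (m l : StrictPartition) : Prop := ∃ b, AddBox m b l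

theorem part_of_length_le (l : StrictPartition) {i : ℕ} (h : l.length ≤ i) : l.part i = 0 := by
  exact List.getD_eq_default _ _ (show l.parts.length ≤ i from h)

theorem part_eq_getElem (l : StrictPartition) {i : ℕ} (h : i < l.length) :
    l.part i = l.parts[i]'h := by
  exact List.getD_eq_getElem _ _ (show i < l.parts.length from h)

theorem part_pos (l : StrictPartition) {i : ℕ} (h : i < l.length) : 0 < l.part i := by
  rw [part_eq_getElem l h]
  exact l.pos _ (List.getElem_mem _)

theorem part_lt_part (l : StrictPartition) {i j : ℕ} (hij : i < j) (hj : j < l.length) :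
    l.part j < l.part i := by
  rw [part_eq_getElem l hj, part_eq_getElem l (hij.trans hj)]
  exact List.pairwise_iff_getElem.1 l.strict i j _ _ hij

theorem mem_boxes (l : StrictPartition) (b : ℕ × ℕ) :
    b ∈ l.boxes ↔ b.1 ≤ b.2 ∧ b.2 < b.1 + l.part b.1 := by
  obtain ⟨i, j⟩ := b
  simp only [boxes, Finset.mem_biUnion, Finset.mem_range, Finset.mem_image, Finset.mem_Ico,
    Prod.mk.injEq]
  constructor
  · rintro ⟨a, -, c, hc, rfl, rfl⟩
    exact hc
  · intro h
    refine ⟨i, ?_, j, h, rfl, rfl⟩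
    by_contra hi
    have := l.part_of_length_le (not_lt.1 hi)
    omega

/-- A strict partition is determined by its shifted Young diagram. -/
theorem boxes_injective : Function.Injective boxes := by
  intro l m h
  have hpart : ∀ i, l.part i = m.part i := by
    intro i
    have key : ∀ j, (i ≤ j ∧ j < i + l.part i) ↔ (i ≤ j ∧ j < i + m.part i) := by
      intro j
      have h1 := l.mem_boxes (i, j)
      rw [h, m.mem_boxes] at h1
      exact h1.symm
    have h1 := key (i + l.part i)
    have h2 := key (i + m.part i)
    omega
  have hlen : l.length = m.length := by
    rcases lt_trichotomy l.length m.length with hl | hl | hl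
    · have h1 := m.part_pos hl
      rw [← hpart, l.part_of_length_le le_rfl] at h1
      omega
    · exact hl
    · have h1 := l.part_pos hl
      rw [hpart, m.part_of_length_le le_rfl] at h1
      omega
  ext1
  refine List.ext_getElem hlen fun i h1 h2 => ?_
  rw [← part_eq_getElem l h1, ← part_eq_getElem m h2, hpart]

/-- A removable box is the last box of its row. -/
theorem AddBox.content_eq {m l : StrictPartition} {b : ℕ × ℕ} (h : AddBox m b l) :
    b.1 < l.length ∧ content b + 1 = l.part b.1 := by
  obtain ⟨i, j⟩ := b
  obtain ⟨hm, hl⟩ := h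
  have hb : (i, j) ∈ l.boxes := by rw [hl]; exact Finset.mem_insert_self _ _
  have hb' := (l.mem_boxes _).1 hb
  simp only at hb'
  have hlast : ¬ (j + 1 < i + l.part i) := by
    intro hj
    have h1 : (i, j + 1) ∈ l.boxes := (l.mem_boxes _).2 ⟨by simp only; omega, hj⟩
    rw [hl, Finset.mem_insert] at h1
    rcases h1 with h1 | h1
    · simp at h1
    · have h2 := (m.mem_boxes _).1 h1
      simp only at h2
      exact hm ((m.mem_boxes _).2 ⟨hb'.1, by simp only; omega⟩)
  refine ⟨?_, ?_⟩
  · by_contra hi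
    have := l.part_of_length_le (not_lt.1 hi)
    simp only at this
    omega
  · simp only [content]
    omega

/-- The box and the smaller diagram are determined by the content of the removed box. -/
theorem AddBox.unique {m m' l : StrictPartition} {b b' : ℕ × ℕ} (h : AddBox m b l)
    (h' : AddBox m' b' l) (hc : content b = content b') : b = b' ∧ m = m' := by
  obtain ⟨h1, h2⟩ := h.content_eq
  obtain ⟨h1', h2'⟩ := h'.content_eq
  have hp : l.part b.1 = l.part b'.1 := by omega
  have hi : b.1 = b'.1 := by
    rcases lt_trichotomy b.1 b'.1 with hl | hl | hl
    · have := l.part_lt_part hl h1'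
      omega
    · exact hl
    · have := l.part_lt_part hl h1
      omega
  have hb : b = b' := by
    refine Prod.ext hi ?_
    simp only [content] at hc
    omega
  subst hb
  refine ⟨rfl, boxes_injective ?_⟩
  rw [← Finset.erase_insert h.1, ← Finset.erase_insert h'.1, ← h.2, ← h'.2]

open Classical in
/-- `Y(l)`: the set of contents of the boxes that can be removed from the shifted diagram `l`. -/
noncomputable def removableContents (l : StrictPartition) : Finset ℤ :=
  (l.boxes.filter fun b => ∃ m, AddBox m b l).image content

open Classical in
/-- `l - □(y)`, for `y ∈ Y(l)`: the unique (by `AddBox.unique`) diagram `m ↗ l` such that the box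
`l/m` has content `y`. (For `y ∉ Y(l)` it is set to be `l`; this value is never used.) -/
noncomputable def removeBox (l : StrictPartition) (y : ℤ) : StrictPartition :=
  if h : ∃ m, ∃ b, AddBox m b l ∧ content b = y then h.choose else l

theorem mem_removableContents {l : StrictPartition} {y : ℤ} :
    y ∈ l.removableContents ↔ ∃ m, ∃ b, AddBox m b l ∧ content b = y := by
  simp only [removableContents, Finset.mem_image, Finset.mem_filter]
  constructor
  · rintro ⟨b, ⟨-, m, h⟩, hy⟩
    exact ⟨m, b, h, hy⟩
  · rintro ⟨m, b, h, hy⟩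
    exact ⟨b, ⟨by rw [h.2]; exact Finset.mem_insert_self _ _, m, h⟩, hy⟩

theorem removeBox_spec {l : StrictPartition} {y : ℤ} (hy : y ∈ l.removableContents) :
    ∃ b, AddBox (l.removeBox y) b l ∧ content b = y := by
  have h := mem_removableContents.1 hy
  rw [removeBox, dif_pos h]
  exact h.choose_spec

end StrictPartition

/-- `𝕊_n`: the set of strict partitions of `n`. -/
def StrictPartitionOf (n : ℕ) : Type := {l : StrictPartition // l.weight = n}

/-- There are finitely many strict partitions of `n`. -/
noncomputable instance StrictPartitionOf.instFintype (n : ℕ) : Fintype (StrictPartitionOf n) :=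
  Fintype.ofInjective
    (fun l : StrictPartitionOf n =>
      (⟨(l.1.parts : Multiset ℕ), fun {k} hk => l.1.pos k (by simpa using hk),
        by rw [Multiset.sum_coe]; exact l.2⟩ : n.Partition))
    (by
      intro l m h
      have h' := congrArg Nat.Partition.parts h
      have hperm : l.1.parts.Perm m.1.parts := Multiset.coe_eq_coe.1 h'
      exact Subtype.ext (StrictPartition.ext (hperm.eq_of_pairwise
        (fun a b _ _ h1 h2 => absurd h1 (by omega)) l.1.strict m.1.strict)))

noncomputable instance StrictPartitionOf.instDecidableEq (n : ℕ) :
    DecidableEq (StrictPartitionOf n) := Classical.decEq _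

namespace SchurGraph

open Classical in
/-- The multiplicity `κ(m, l)` of the edge from `m` to `l` in the Schur graph: it is nonzero only if
`m ↗ l`, and then it is `2` if `ℓ(l) = ℓ(m)` and `1` if `ℓ(l) = ℓ(m) + 1`. -/
noncomputable def edgeMult (m l : StrictPartition) : ℕ :=
  if m.Covers l then (if l.length = m.length then 2 else 1) else 0

open Classical in
/-- The number of oriented paths with `k` edges from `m` to `l` in the Schur graph, edges being
counted with their multiplicities. The last but one vertex of such a path lies on the floor
`|m| + k - 1`. -/
noncomputable def numPaths : ℕ → StrictPartition → StrictPartition → ℕ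
  | 0, m, l => if m = l then 1 else 0
  | k + 1, m, l => ∑ v : StrictPartitionOf (m.weight + k), numPaths k m v.1 * edgeMult v.1 l

/-- `h(l)`: the total number of oriented paths from the empty diagram to `l`. (The graph is graded
by the weight, so every such path has `|l|` edges.) -/
noncomputable def dim (l : StrictPartition) : ℕ := numPaths l.weight StrictPartition.empty l

/-- The down transition function `p↓(l, m) = h(m) κ(m, l) / h(l)`, where `|l| = |m| + 1`. -/
noncomputable def downProb (l m : StrictPartition) : ℝ :=
  (dim m : ℝ) / (dim l : ℝ) * (edgeMult m l : ℝ)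

/-- The up transition function `p↑(l, v) = M(v) p↓(v, l) / M(l)`, where `|v| = |l| + 1`, of a system
of measures; `M l` is the mass of the singleton `{l}` with respect to the measure on `𝕊_{|l|}`. -/
noncomputable def upProb (M : StrictPartition → ℝ) (l v : StrictPartition) : ℝ :=
  M v / M l * downProb v l

/-- The Plancherel measure `Pl_n(l) = h(l)² 2^(ℓ(l) - n) / n!` of `l`, where `n = |l|`. -/
noncomputable def plancherel (l : StrictPartition) : ℝ :=
  (dim l : ℝ) ^ 2 / (l.weight.factorial : ℝ) * (2 : ℝ) ^ ((l.length : ℤ) - (l.weight : ℤ))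

/-- The multiplicative measure with parameter `α`: its value at `l`, where `n = |l|`, is
`Pl_n(l) · ∏_{□ ∈ l} (c(□)(c(□) + 1) + α) / (α (α + 2) ⋯ (α + 2n - 2))`. -/
noncomputable def multMeasure (α : ℝ) (l : StrictPartition) : ℝ :=
  plancherel l * (1 / ∏ k ∈ Finset.range l.weight, (α + 2 * (k : ℝ))) *
    ∏ b ∈ l.boxes,
      ((StrictPartition.content b : ℝ) * ((StrictPartition.content b : ℝ) + 1) + α)

/-- The transition matrix of the `n`-th up/down Markov chain on `𝕊_n` associated with the
multiplicative measures with parameter `α`. -/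
noncomputable def transitionMatrix (α : ℝ) (n : ℕ) :
    Matrix (StrictPartitionOf n) (StrictPartitionOf n) ℝ :=
  Matrix.of fun l l' =>
    ∑ v : StrictPartitionOf (n + 1), upProb (multMeasure α) l.1 v.1 * downProb v.1 l'.1

/-- The transition operator `T_n` on functions on `𝕊_n`:
`(T_n f)(l) = ∑_{l'} T_n(l, l') f(l')`. -/
noncomputable def transitionOp (α : ℝ) (n : ℕ) :
    (StrictPartitionOf n → ℝ) →ₗ[ℝ] (StrictPartitionOf n → ℝ) :=
  (transitionMatrix α n).mulVecLin

/-- `R*_{m|n}(y_1, …, y_n) = ∏_{i ≤ ℓ(m)} y_i^{↓ m_i} · ∏_{i ≤ ℓ(m), i < j ≤ n} (y_i + y_j)/(y_i - y_j)`,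
where `a^{↓ k} = a (a - 1) ⋯ (a - k + 1)`; it is used for `n ≥ ℓ(m)` and distinct `y_i`. -/
noncomputable def factorialR (m : StrictPartition) (n : ℕ) (y : Fin n → ℝ) : ℝ :=
  (∏ i : Fin n with i.val < m.length, (descPochhammer ℝ (m.part i)).eval (y i)) *
    ∏ p : Fin n × Fin n with p.1.val < m.length ∧ p.1 < p.2,
      (y p.1 + y p.2) / (y p.1 - y p.2)

/-- The factorial Schur Q-function `Q*_m(y_1, …, y_n, 0, 0, …)` at distinct real `y_1, …, y_n`:
`2^ℓ(m) / (n - ℓ(m))! · ∑_{w ∈ S_n} R*_{m|n}(y_{w(1)}, …, y_{w(n)})` if `n ≥ ℓ(m)`, and `0` if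
`n < ℓ(m)`. -/
noncomputable def factorialQ (m : StrictPartition) (n : ℕ) (y : Fin n → ℝ) : ℝ :=
  if m.length ≤ n then
    (2 : ℝ) ^ m.length / ((n - m.length).factorial : ℝ) *
      ∑ w : Equiv.Perm (Fin n), factorialR m n (y ∘ w)
  else 0

/-- The factorial Schur Q-function as a function on strict partitions:
`Q*_m(l) = Q*_m(l_1, …, l_{ℓ(l)}, 0, 0, …)`. The parts `l_1 > ⋯ > l_{ℓ(l)}` are distinct, so no
denominator vanishes. -/
noncomputable def factorialQFun (m l : StrictPartition) : ℝ :=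
  factorialQ m l.length fun i => (l.part i : ℝ)

/-- The restriction `f_n` to `𝕊_n` of a function `f` on strict partitions. -/
def restrict (n : ℕ) (f : StrictPartition → ℝ) : StrictPartitionOf n → ℝ := fun l => f l.1

end SchurGraph

/-! Write $P(\mu,\lambda)$ for the number of paths from $\mu$ to $\lambda$ and $w_k=k(k+1)+\alpha$.
The functions $\mathcal Q^*_\mu$ are path counts in disguise: for $|\lambda|=n$, $\mathcal
Q^*_\mu(\lambda)\,\mathsf h(\lambda)=2^{|\mu|}\,n^{\downarrow|\mu|}\,P(\mu,\lambda)$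
(`factorialQFun_mul_dim`). The down step is then the recursion for $P$ over the last edge
(`sum_downProb_mul_factorialQFun`). In the up step everything cancels except the weight of the added
box: adding a box of content $k$ has probability $\mathsf h(\nu)\,w_k/\big(\mathsf
h(\lambda)(n+1)(\alpha+2n)\big)$ (`upProb_multMeasure_raise`). So $T_n\mathcal Q^*_\mu(\lambda)$ is
an explicit multiple of $\sum_k w_k\,P(\mu,\lambda+\square(k))$.

That sum is computed by an $\mathfrak{sl}_2$-type argument. The commutator of the raising operator
with weights $w_k$ and the lowering operator with edge multiplicities is diagonal, with value
$\alpha+4|\lambda|$ (`raise_lower_commutator`). Moving the raising step through a path one edge at a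
time, until it cancels a box of $\mu$, gives $\sum_k w_kP(\mu,\lambda+\square(k))=\sum_k
w_kP(\mu-\square(k),\lambda)+(n-|\mu|+1)(\alpha+2n+2|\mu|)P(\mu,\lambda)$
(`sum_boxWeight_mul_pathCount`), and the theorem follows by comparing coefficients.

The path formula itself holds because both sides satisfy one recursion in $\lambda$ and agree for
$|\lambda|=|\mu|$. Multiplying the symmetrised sum by the product formula for $\mathsf h$ removes
its denominators and makes it alternating (`dimWeight_mul_factorialQ`). The effect of decreasing one
variable at a time is then a Lagrange interpolation identity (`sum_mul_prod_lower_ratio`). -/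

section

open Finset

/-! ### Strict partitions as sets of parts; adding and removing boxes -/

namespace StrictPartition

/-- The set of parts of a strict partition. -/
def partSet (l : StrictPartition) : Finset ℕ := l.parts.toFinset

/-- The strict partition whose parts are the nonzero elements of a finite set. -/
def ofSet (S : Finset ℕ) : StrictPartition where
  parts := (S.erase 0).sort (fun a b => b ≤ a)
  strict := by
    have h1 := (S.erase 0).pairwise_sort (fun a b => b ≤ a)
    have h2 := (S.erase 0).sort_nodup (fun a b => b ≤ a)
    exact (h1.and h2).imp fun h => lt_of_le_of_ne h.1 (Ne.symm h.2)
  pos := by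
    intro k hk
    rw [mem_sort, mem_erase] at hk
    exact Nat.pos_of_ne_zero hk.1

theorem nodup_parts (l : StrictPartition) : l.parts.Nodup :=
  l.strict.imp fun h => (ne_of_lt h).symm

theorem zero_notMem_partSet (l : StrictPartition) : 0 ∉ l.partSet := by
  intro h
  exact lt_irrefl _ (l.pos 0 (List.mem_toFinset.1 h))

theorem partSet_ofSet (S : Finset ℕ) : (ofSet S).partSet = S.erase 0 :=
  sort_toFinset _ _

theorem ofSet_partSet (l : StrictPartition) : ofSet l.partSet = l := by
  ext1
  change (l.partSet.erase 0).sort (fun a b => b ≤ a) = l.parts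
  rw [erase_eq_of_notMem l.zero_notMem_partSet]
  exact (List.toFinset_sort _ l.nodup_parts).2 (l.strict.imp le_of_lt)

theorem partSet_injective : Function.Injective partSet :=
  Function.LeftInverse.injective ofSet_partSet

theorem card_partSet (l : StrictPartition) : l.partSet.card = l.length :=
  List.toFinset_card_of_nodup l.nodup_parts

theorem sum_partSet (l : StrictPartition) : ∑ a ∈ l.partSet, a = l.weight := by
  have h := List.sum_toFinset (fun a : ℕ => a) l.nodup_parts
  simpa [partSet, weight] using h

theorem le_weight_of_mem_partSet {l : StrictPartition} {a : ℕ} (h : a ∈ l.partSet) :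
    a ≤ l.weight := by
  rw [← sum_partSet]
  exact single_le_sum (f := fun a : ℕ => a) (fun _ _ => Nat.zero_le _) h

theorem mem_partSet_iff {l : StrictPartition} {a : ℕ} :
    a ∈ l.partSet ↔ 0 < a ∧ ∃ i, l.part i = a := by
  constructor
  · intro h
    have h' := List.mem_toFinset.1 h
    obtain ⟨i, hi, rfl⟩ := List.mem_iff_getElem.1 h'
    exact ⟨l.pos _ h', i, l.part_eq_getElem hi⟩
  · rintro ⟨h, i, rfl⟩
    have hi : i < l.length := by
      by_contra hi
      rw [l.part_of_length_le (not_lt.1 hi)] at h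
      exact lt_irrefl _ h
    rw [l.part_eq_getElem hi]
    exact List.mem_toFinset.2 (List.getElem_mem _)

theorem part_mem_partSet {l : StrictPartition} {i : ℕ} (hi : i < l.length) :
    l.part i ∈ l.partSet :=
  mem_partSet_iff.2 ⟨l.part_pos hi, i, rfl⟩

theorem lt_length_of_part_pos {l : StrictPartition} {i : ℕ} (h : 0 < l.part i) :
    i < l.length := by
  by_contra hi
  rw [l.part_of_length_le (not_lt.1 hi)] at h
  exact lt_irrefl _ h

theorem part_inj {l : StrictPartition} {i j : ℕ} (hi : 0 < l.part i)
    (h : l.part i = l.part j) : i = j := by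
  have h1 := lt_length_of_part_pos hi
  have h2 := lt_length_of_part_pos (h ▸ hi)
  rcases lt_trichotomy i j with hl | hl | hl
  · have := l.part_lt_part hl h2
    omega
  · exact hl
  · have := l.part_lt_part hl h1
    omega

/-- Adding a box means increasing one part by one. -/
theorem addBox_iff {m l : StrictPartition} {b : ℕ × ℕ} :
    AddBox m b l ↔ b.2 = b.1 + m.part b.1 ∧ l.part b.1 = m.part b.1 + 1 ∧
      ∀ i, i ≠ b.1 → l.part i = m.part i := by
  obtain ⟨i, j⟩ := b
  constructor
  · rintro ⟨h1, h2⟩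
    have key : ∀ a c, (a ≤ c ∧ c < a + l.part a) ↔
        ((a = i ∧ c = j) ∨ (a ≤ c ∧ c < a + m.part a)) := by
      intro a c
      have := l.mem_boxes (a, c)
      rw [h2, mem_insert, m.mem_boxes, Prod.mk.injEq] at this
      exact this.symm
    have h3 : ¬ (i ≤ j ∧ j < i + m.part i) := fun h => h1 ((m.mem_boxes _).2 h)
    have e0 := key i j
    have e1 := key i (i + m.part i)
    have e2 := key i (i + l.part i)
    have e3 := key i (i + m.part i + 1)
    have e4 := key i (i + l.part i - 1)
    refine ⟨by simp only; omega, by simp only; omega, fun a ha => ?_⟩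
    simp only at ha
    have e1 := key a (a + m.part a)
    have e2 := key a (a + l.part a)
    omega
  · rintro ⟨h1, h2, h3⟩
    simp only at h1 h2 h3
    refine ⟨fun h => ?_, ?_⟩
    · have := (m.mem_boxes _).1 h
      simp only at this
      omega
    · ext ⟨a, c⟩
      rw [mem_insert, l.mem_boxes, m.mem_boxes, Prod.mk.injEq]
      simp only
      by_cases ha : a = i
      · subst ha
        omega
      · rw [h3 a ha]
        simp [ha]

/-- A sequence that decreases strictly until it vanishes comes from a strict partition. -/
theorem exists_part_eq (f : ℕ → ℕ) (N : ℕ) (h0 : ∀ i, N ≤ i → f i = 0)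
    (hpos : ∀ i, i < N → 0 < f i) (h : ∀ i j, i < j → j < N → f j < f i) :
    ∃ m : StrictPartition, ∀ i, m.part i = f i := by
  refine ⟨⟨(List.range N).map f, ?_, ?_⟩, fun i => ?_⟩
  · rw [List.pairwise_map]
    refine List.pairwise_iff_getElem.2 fun i j hi hj hij => ?_
    simp only [List.getElem_range]
    exact h i j hij (by simpa using hj)
  · intro k hk
    obtain ⟨i, hi, rfl⟩ := List.mem_map.1 hk
    exact hpos i (List.mem_range.1 hi)
  · change ((List.range N).map f).getD i 0 = f i
    by_cases hi : i < N
    · rw [List.getD_eq_getElem _ _ (by simpa using hi)]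
      simp
    · rw [List.getD_eq_default _ _ (by simpa using hi), h0 i (not_lt.1 hi)]

/-- The strict partition in which the part `k` is replaced by `k + 1`
(a new part `1` if `k = 0`). -/
def raise (l : StrictPartition) (k : ℕ) : StrictPartition :=
  ofSet (insert (k + 1) (l.partSet.erase k))

/-- The strict partition in which the part `k + 1` is replaced by `k`. -/
def lower (l : StrictPartition) (k : ℕ) : StrictPartition :=
  ofSet (insert k (l.partSet.erase (k + 1)))

/-- A box of content `k` can be added. -/
def CanRaise (l : StrictPartition) (k : ℕ) : Prop :=
  (k = 0 ∨ k ∈ l.partSet) ∧ k + 1 ∉ l.partSet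

/-- A box of content `k` can be removed. -/
def CanLower (l : StrictPartition) (k : ℕ) : Prop :=
  k + 1 ∈ l.partSet ∧ k ∉ l.partSet

instance (l : StrictPartition) (k : ℕ) : Decidable (l.CanRaise k) := by
  unfold CanRaise; infer_instance

instance (l : StrictPartition) (k : ℕ) : Decidable (l.CanLower k) := by
  unfold CanLower; infer_instance

theorem partSet_raise (l : StrictPartition) (k : ℕ) :
    (l.raise k).partSet = insert (k + 1) (l.partSet.erase k) := by
  rw [raise, partSet_ofSet, erase_eq_of_notMem]
  simp [l.zero_notMem_partSet]

theorem partSet_lower (l : StrictPartition) (k : ℕ) :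
    (l.lower k).partSet = (insert k (l.partSet.erase (k + 1))).erase 0 := by
  rw [lower, partSet_ofSet]

theorem AddBox.content_eq_part {m l : StrictPartition} {b : ℕ × ℕ} (h : AddBox m b l) :
    content b = (m.part b.1 : ℤ) := by
  rw [addBox_iff] at h
  simp only [content]
  omega

theorem AddBox.canLower {m l : StrictPartition} {b : ℕ × ℕ} (h : AddBox m b l) :
    l.CanLower (m.part b.1) ∧ m = l.lower (m.part b.1) := by
  rw [addBox_iff] at h
  obtain ⟨-, h2, h3⟩ := h
  have hm : ∀ a, a ∈ m.partSet ↔ 0 < a ∧ (a = m.part b.1 ∨ (a ≠ m.part b.1 + 1 ∧ a ∈ l.partSet)) := by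
    intro a
    rw [mem_partSet_iff, mem_partSet_iff]
    constructor
    · rintro ⟨ha, i, rfl⟩
      refine ⟨ha, ?_⟩
      by_cases hi : i = b.1
      · left; rw [hi]
      · right
        refine ⟨fun h => ?_, ha, i, h3 i hi⟩
        rw [← h2, ← h3 i hi] at h
        exact hi (part_inj (by rw [h3 i hi]; exact ha) h)
    · rintro ⟨ha, h | ⟨h, -, i, hi⟩⟩
      · exact ⟨ha, b.1, h.symm⟩
      · refine ⟨ha, i, ?_⟩
        rw [← h3 i, hi]
        rintro rfl
        omega
  refine ⟨⟨mem_partSet_iff.2 ⟨by omega, b.1, h2⟩, fun h => ?_⟩, ?_⟩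
  · obtain ⟨h0, i, hi⟩ := mem_partSet_iff.1 h
    have hib : i ≠ b.1 := by rintro rfl; omega
    rw [h3 i hib] at hi
    exact hib (part_inj (by omega) hi)
  · apply partSet_injective
    rw [partSet_lower]
    ext a
    rw [hm, mem_erase, mem_insert, mem_erase, Nat.pos_iff_ne_zero]

theorem CanLower.exists_addBox {l : StrictPartition} {k : ℕ} (h : l.CanLower k) :
    ∃ b, AddBox (l.lower k) b l ∧ (l.lower k).part b.1 = k := by
  obtain ⟨h1, h2⟩ := h
  obtain ⟨-, i, hi⟩ := mem_partSet_iff.1 h1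
  have hil := lt_length_of_part_pos (l := l) (i := i) (by omega)
  obtain ⟨m, hm⟩ := exists_part_eq (fun j => if j = i then k else l.part j)
    -- If `k = 0`, the row `i` has length 1, hence is the last one, and it disappears.
    (if k = 0 then i else l.length)
    (by
      intro j hj
      split_ifs at hj with hk
      · split_ifs with hji
        · exact hk
        · by_contra h0
          have h4 := lt_length_of_part_pos (Nat.pos_of_ne_zero h0)
          have h3 := l.part_lt_part (lt_of_le_of_ne hj (Ne.symm hji)) h4
          omega
      · rw [if_neg (by omega), l.part_of_length_le hj])
    (by
      intro j hj
      split_ifs at hj with hk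
      · rw [if_neg (by omega)]
        exact l.part_pos (by omega)
      · split_ifs with hji
        · omega
        · exact l.part_pos hj)
    (by
      intro a c hac hc
      have hc' : c < l.length := by split_ifs at hc <;> omega
      have hlt := l.part_lt_part hac hc'
      split_ifs with h3 h4 h4
      · omega
      · subst h3; omega
      · subst h4
        have : l.part c ≠ k := by
          rintro rfl
          exact h2 (part_mem_partSet hc')
        omega
      · exact hlt)
  have hmi : m.part i = k := by rw [hm]; simp
  have hadd : AddBox m (i, i + k) l := by
    rw [addBox_iff]
    refine ⟨by simp [hmi], by simp [hmi, hi], fun j hj => ?_⟩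
    rw [hm, if_neg hj]
  have := hadd.canLower.2
  simp only [hmi] at this
  exact ⟨(i, i + k), this ▸ ⟨hadd, hmi⟩⟩

theorem addBox_content_iff {m l : StrictPartition} {k : ℕ} :
    (∃ b, AddBox m b l ∧ content b = (k : ℤ)) ↔ l.CanLower k ∧ m = l.lower k := by
  constructor
  · rintro ⟨b, h, hc⟩
    rw [h.content_eq_part] at hc
    have hc' : m.part b.1 = k := by exact_mod_cast hc
    have := h.canLower
    rwa [hc'] at this
  · rintro ⟨h, rfl⟩
    obtain ⟨b, hb, hc⟩ := h.exists_addBox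
    exact ⟨b, hb, by rw [hb.content_eq_part, hc]⟩

theorem covers_iff {m l : StrictPartition} :
    m.Covers l ↔ ∃ k, l.CanLower k ∧ m = l.lower k := by
  constructor
  · rintro ⟨b, h⟩
    exact ⟨_, h.canLower⟩
  · rintro ⟨k, h⟩
    obtain ⟨b, hb, -⟩ := addBox_content_iff.2 h
    exact ⟨b, hb⟩

theorem CanLower.canRaise_lower {l : StrictPartition} {k : ℕ} (_ : l.CanLower k) :
    (l.lower k).CanRaise k := by
  unfold CanRaise
  by_cases hk : k = 0 <;> simp [partSet_lower, hk]

theorem CanLower.raise_lower {l : StrictPartition} {k : ℕ} (h : l.CanLower k) :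
    (l.lower k).raise k = l := by
  apply partSet_injective
  rw [partSet_raise, partSet_lower]
  ext a
  have h0 := l.zero_notMem_partSet
  obtain ⟨h1, h2⟩ := h
  simp only [mem_erase, mem_insert]
  by_cases ha : a = k + 1
  · subst ha; simp [h1]
  · by_cases ha' : a = k
    · subst ha'; simp [h2]
    · by_cases ha0 : a = 0
      · subst ha0; simp [h0]
      · simp [ha, ha', ha0]

theorem CanRaise.canLower_raise {l : StrictPartition} {k : ℕ} (_ : l.CanRaise k) :
    (l.raise k).CanLower k := by
  unfold CanLower
  simp [partSet_raise]

theorem CanRaise.lower_raise {l : StrictPartition} {k : ℕ} (h : l.CanRaise k) :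
    (l.raise k).lower k = l := by
  apply partSet_injective
  rw [partSet_lower, partSet_raise]
  ext a
  have h0 := l.zero_notMem_partSet
  obtain ⟨h1, h2⟩ := h
  simp only [mem_erase, mem_insert]
  by_cases ha : a = k + 1
  · subst ha; simp [h2]
  · by_cases ha' : a = k
    · subst ha'
      by_cases ha0 : a = 0
      · subst ha0; simp [h0]
      · simp [ha0, h1.resolve_left ha0]
    · by_cases ha0 : a = 0
      · subst ha0; simp [h0]
      · simp [ha, ha', ha0]

theorem addBox_content_iff_raise {m l : StrictPartition} {k : ℕ} :
    (∃ b, AddBox m b l ∧ content b = (k : ℤ)) ↔ m.CanRaise k ∧ l = m.raise k := by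
  rw [addBox_content_iff]
  constructor
  · rintro ⟨h, rfl⟩
    exact ⟨h.canRaise_lower, h.raise_lower.symm⟩
  · rintro ⟨h, rfl⟩
    exact ⟨h.canLower_raise, h.lower_raise.symm⟩

theorem covers_iff_raise {m l : StrictPartition} :
    m.Covers l ↔ ∃ k, m.CanRaise k ∧ l = m.raise k := by
  rw [covers_iff]
  refine exists_congr fun k => ?_
  rw [← addBox_content_iff, addBox_content_iff_raise]

theorem CanLower.weight_lower {l : StrictPartition} {k : ℕ} (h : l.CanLower k) :
    (l.lower k).weight + 1 = l.weight := by
  obtain ⟨h1, h2⟩ := h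
  rw [← sum_partSet, ← sum_partSet, partSet_lower, sum_erase (f := fun a : ℕ => a) _ rfl,
    sum_insert (by simp [h2]), ← add_sum_erase _ _ h1]
  omega

theorem CanRaise.weight_raise {l : StrictPartition} {k : ℕ} (h : l.CanRaise k) :
    (l.raise k).weight = l.weight + 1 := by
  have := h.canLower_raise.weight_lower
  rw [h.lower_raise] at this
  exact this.symm

theorem CanLower.length_lower {l : StrictPartition} {k : ℕ} (h : l.CanLower k) :
    l.length = (l.lower k).length + if k = 0 then 1 else 0 := by
  obtain ⟨h1, h2⟩ := h
  have h3 := card_erase_add_one h1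
  rw [← card_partSet, ← card_partSet, partSet_lower]
  split_ifs with hk
  · subst hk
    rw [erase_insert, h3]
    simp [l.zero_notMem_partSet]
  · rw [erase_eq_of_notMem, card_insert_of_notMem (by simp [h2]), h3]
    simp [l.zero_notMem_partSet, Ne.symm hk]

theorem CanLower.lt {l : StrictPartition} {k : ℕ} (h : l.CanLower k) : k < l.weight :=
  le_weight_of_mem_partSet h.1

theorem CanRaise.le {l : StrictPartition} {k : ℕ} (h : l.CanRaise k) : k ≤ l.weight := by
  rcases h.1 with rfl | h
  · exact Nat.zero_le _
  · exact le_weight_of_mem_partSet h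

theorem CanLower.inj {l : StrictPartition} {j k : ℕ} (hj : l.CanLower j) (hk : l.CanLower k)
    (h : l.lower j = l.lower k) : j = k := by
  have h1 := congrArg (fun m => k + 1 ∈ m.partSet) h
  simp only [partSet_lower, mem_erase, mem_insert, eq_iff_iff] at h1
  by_cases h2 : j = k + 1
  · subst h2
    exact absurd hk.1 hj.2
  · have h3 : ¬ (k + 1 = k) := by omega
    have h5 : ¬ (k + 1 = j) := by omega
    simp only [h3, h5, hk.1] at h1
    simp at h1
    exact h1.symm

theorem CanRaise.inj {l : StrictPartition} {j k : ℕ} (hk : l.CanRaise k)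
    (h : l.raise j = l.raise k) : j = k := by
  by_contra hne
  have h1 := congrArg (fun m => k + 1 ∈ m.partSet) h
  simp only [partSet_raise, mem_erase, mem_insert, eq_iff_iff] at h1
  have h2 := hk.2
  have h3 : ¬ (k + 1 = j + 1) := by omega
  simp only [h2, h3] at h1
  simp at h1

/-- Diagrams covered by `l` are indexed by the content of the removed box. The free bound `K` allows
sums attached to different diagrams to share one range, so that they can be interchanged. -/
theorem sum_covers_below {M : Type*} [AddCommMonoid M] {l : StrictPartition} {n K : ℕ}
    (hn : l.weight = n + 1) (hK : n < K) (φ : StrictPartition → M)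
    (hφ : ∀ m : StrictPartition, ¬ m.Covers l → φ m = 0) :
    ∑ v : StrictPartitionOf n, φ v.1 =
      ∑ k ∈ range K, if l.CanLower k then φ (l.lower k) else 0 := by
  rw [← sum_filter]
  symm
  refine sum_bij_ne_zero
    (fun k hk _ => (⟨l.lower k, by
      have := (mem_filter.1 hk).2.weight_lower
      omega⟩ : StrictPartitionOf n)) (fun _ _ _ => mem_univ _) ?_ ?_ (fun _ _ _ => rfl)
  · intro j hj _ k hk _ h
    exact (mem_filter.1 hj).2.inj (mem_filter.1 hk).2 (congrArg Subtype.val h)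
  · rintro ⟨v, hv⟩ - hne
    have hc : v.Covers l := by
      by_contra h
      exact hne (hφ v h)
    obtain ⟨k, hk, rfl⟩ := covers_iff.1 hc
    have := hk.lt
    exact ⟨k, mem_filter.2 ⟨mem_range.2 (by omega), hk⟩, hne, rfl⟩

theorem sum_covers_above {M : Type*} [AddCommMonoid M] {l : StrictPartition} {n K : ℕ}
    (hn : l.weight = n) (hK : n < K) (φ : StrictPartition → M)
    (hφ : ∀ m : StrictPartition, ¬ l.Covers m → φ m = 0) :
    ∑ v : StrictPartitionOf (n + 1), φ v.1 =
      ∑ k ∈ range K, if l.CanRaise k then φ (l.raise k) else 0 := by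
  rw [← sum_filter]
  symm
  refine sum_bij_ne_zero
    (fun k hk _ => (⟨l.raise k, by
      have := (mem_filter.1 hk).2.weight_raise
      omega⟩ : StrictPartitionOf (n + 1))) (fun _ _ _ => mem_univ _) ?_ ?_ (fun _ _ _ => rfl)
  · intro j _ _ k hk _ h
    exact CanRaise.inj (mem_filter.1 hk).2 (congrArg Subtype.val h)
  · rintro ⟨v, hv⟩ - hne
    have hc : l.Covers v := by
      by_contra h
      exact hne (hφ v h)
    obtain ⟨k, hk, rfl⟩ := covers_iff_raise.1 hc
    have := hk.le
    exact ⟨k, mem_filter.2 ⟨mem_range.2 (by omega), hk⟩, hne, rfl⟩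

theorem sum_removableContents {M : Type*} [AddCommMonoid M] {l : StrictPartition} {K : ℕ}
    (hK : l.weight ≤ K) (φ : ℤ → StrictPartition → M) :
    ∑ y ∈ l.removableContents, φ y (l.removeBox y) =
      ∑ k ∈ range K, if l.CanLower k then φ k (l.lower k) else 0 := by
  rw [← sum_filter]
  symm
  refine sum_bij (fun k _ => (k : ℤ)) ?_ ?_ ?_ ?_
  · intro k hk
    obtain ⟨b, hb⟩ := addBox_content_iff.2 ⟨(mem_filter.1 hk).2, rfl⟩
    exact mem_removableContents.2 ⟨_, b, hb⟩
  · intro j _ k _ h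
    exact_mod_cast h
  · intro y hy
    obtain ⟨m, b, hb, hc⟩ := mem_removableContents.1 hy
    have h := hb.content_eq_part
    have h' := hb.canLower
    have := h'.1.lt
    exact ⟨_, mem_filter.2 ⟨mem_range.2 (by omega), h'.1⟩, by rw [← h, hc]⟩
  · intro k hk
    obtain ⟨b, hb⟩ := addBox_content_iff.2 ⟨(mem_filter.1 hk).2, rfl⟩
    have hy := removeBox_spec (mem_removableContents.2 ⟨_, b, hb⟩)
    rw [(addBox_content_iff.1 hy).2]

end StrictPartition

/-! ### The commutation relation and path counts -/

namespace StrictPartition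

/-- The two moves touch the parts `j`, `j + 1` and `k`, `k + 1`. These pairs overlap only if `k = j
+ 1` or `j = k + 1`, and then each move blocks the other, so that both sides are false. -/
theorem canRaise_and_canLower_comm {l : StrictPartition} {j k : ℕ} (h : j ≠ k) :
    (l.CanRaise j ∧ (l.raise j).CanLower k) ↔ (l.CanLower k ∧ (l.lower k).CanRaise j) := by
  unfold CanRaise CanLower
  simp only [partSet_raise, partSet_lower, mem_erase, mem_insert]
  by_cases h1 : k + 1 = j
  · subst h1
    simp
  · by_cases h2 : k = j + 1
    · subst h2
      simp
    · have h3 : ¬ (k + 1 = j + 1) := by omega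
      have h4 : ¬ (j + 1 = k) := by omega
      simp only [h2, h3, h4, h]
      by_cases h0 : j = 0
      · subst h0
        simp
        tauto
      · simp [h0]
        tauto

theorem lower_raise_comm {l : StrictPartition} {j k : ℕ} (h : j ≠ k)
    (h1 : l.CanRaise j) (h2 : (l.raise j).CanLower k) :
    (l.raise j).lower k = (l.lower k).raise j := by
  obtain ⟨h3, h4⟩ := (canRaise_and_canLower_comm h).1 ⟨h1, h2⟩
  apply partSet_injective
  rw [partSet_lower, partSet_raise, partSet_raise, partSet_lower]
  ext a
  have h1' := h1.2
  have h2' := h2.2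
  have h3' := h3
  obtain ⟨h5, h6⟩ := h3'
  simp only [partSet_raise, mem_insert, mem_erase, not_or] at h2'
  simp only [mem_insert, mem_erase]
  by_cases ha : a = j + 1
  · subst ha
    simp [h]
  · by_cases ha0 : a = 0
    · subst ha0
      simp
    · by_cases hak : a = k
      · subst hak
        simp [ha0, Ne.symm h]
      · simp [ha, ha0, hak]
        tauto

/-- Raising and lowering operators at different contents commute. -/
theorem raise_lower_sum_comm {M : Type*} [Zero M] (f : StrictPartition → M) (l : StrictPartition)
    {j k : ℕ} (h : j ≠ k) :
    (if l.CanRaise j then if (l.raise j).CanLower k then f ((l.raise j).lower k) else 0 else 0) =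
      if l.CanLower k then if (l.lower k).CanRaise j then f ((l.lower k).raise j) else 0 else 0 := by
  rw [← ite_and, ← ite_and]
  by_cases h1 : l.CanRaise j ∧ (l.raise j).CanLower k
  · rw [if_pos h1, if_pos ((canRaise_and_canLower_comm h).1 h1), lower_raise_comm h h1.1 h1.2]
  · rw [if_neg h1, if_neg (mt (canRaise_and_canLower_comm h).2 h1)]

end StrictPartition

namespace SchurGraph
open StrictPartition

/-- The weight `k (k + 1) + α` of a box of content `k`. -/
def boxWeight (α : ℝ) (k : ℕ) : ℝ := (k : ℝ) * ((k : ℝ) + 1) + α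

/-- The multiplicity of the edges that add a box of content `k`. -/
def contentMult (k : ℕ) : ℝ := if k = 0 then 1 else 2

theorem CanLower.edgeMult_eq {l : StrictPartition} {k : ℕ} (h : l.CanLower k) :
    (edgeMult (l.lower k) l : ℝ) = contentMult k := by
  rw [edgeMult, if_pos (covers_iff.2 ⟨k, h, rfl⟩), h.length_lower, contentMult]
  split_ifs <;> simp_all

theorem CanRaise.edgeMult_eq {l : StrictPartition} {k : ℕ} (h : l.CanRaise k) :
    (edgeMult l (l.raise k) : ℝ) = contentMult k := by
  have := CanLower.edgeMult_eq h.canLower_raise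
  rwa [h.lower_raise] at this

theorem edgeMult_eq_zero {m l : StrictPartition} (h : ¬ m.Covers l) : edgeMult m l = 0 := by
  rw [edgeMult, if_neg h]

theorem sum_mul_edgeMult {l : StrictPartition} {n K : ℕ} (hn : l.weight = n + 1) (hK : n < K)
    (f : StrictPartition → ℝ) :
    ∑ v : StrictPartitionOf n, f v.1 * edgeMult v.1 l =
      ∑ k ∈ range K, if l.CanLower k then contentMult k * f (l.lower k) else 0 := by
  rw [sum_covers_below hn hK (fun v => f v * edgeMult v l)
    (fun m hm => by simp [edgeMult_eq_zero hm])]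
  refine sum_congr rfl fun k _ => ?_
  split_ifs with h
  · rw [CanLower.edgeMult_eq h, mul_comm]
  · rfl

/-- The diagonal part of the commutator of the raising and the lowering operators. -/
theorem sum_boxWeight_diag (α : ℝ) (l : StrictPartition) {K : ℕ} (hK : l.weight < K) :
    ∑ k ∈ range K, boxWeight α k * contentMult k *
      ((if l.CanRaise k then 1 else 0) - (if l.CanLower k then 1 else 0)) =
      α + 4 * (l.weight : ℝ) := by
  -- For `k > 0` the difference of indicators is `[k ∈ S] - [k + 1 ∈ S]`, with `S` the set of parts.
  -- Since `2 (k (k + 1) + α) = 4 k + 2 (k (k - 1) + α)`, what remains beside `4 k` telescopes. At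
  -- `k = 0` the difference is `1 - 2 [1 ∈ S]`; the multiplicity 1 instead of 2 fits it into the
  -- same telescope and leaves the extra `α`.
  have key : ∀ k, boxWeight α k * contentMult k *
      ((if l.CanRaise k then 1 else 0) - (if l.CanLower k then 1 else 0)) =
      (if k = 0 then α else 0) + (4 * (if k ∈ l.partSet then (k : ℝ) else 0) +
        ((if k ∈ l.partSet then 2 * ((k : ℝ) * (k - 1) + α) else 0) -
          (if k + 1 ∈ l.partSet then 2 * (((k + 1 : ℕ) : ℝ) * ((k + 1 : ℕ) - 1) + α) else 0))) := by
    intro k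
    unfold CanRaise CanLower boxWeight contentMult
    have h0 := l.zero_notMem_partSet
    by_cases hk : k = 0
    · subst hk
      by_cases h1 : 1 ∈ l.partSet <;> simp [h0, h1]
      ring
    · by_cases h1 : k ∈ l.partSet <;> by_cases h2 : k + 1 ∈ l.partSet <;>
        simp [hk, h1, h2] <;> ring
  simp_rw [key]
  rw [sum_add_distrib, sum_add_distrib, ← mul_sum, sum_range_sub', sum_ite_eq' (range K) 0,
    if_pos (mem_range.2 (by omega)), ← sum_filter]
  have hf : (range K).filter (· ∈ l.partSet) = l.partSet := by
    ext a
    simp only [mem_filter, mem_range, and_iff_right_iff_imp]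
    intro ha
    have := le_weight_of_mem_partSet ha
    omega
  have hKn : K ∉ l.partSet := fun h => by
    have := le_weight_of_mem_partSet h
    omega
  rw [hf, if_neg l.zero_notMem_partSet, if_neg hKn, ← l.sum_partSet]
  push_cast
  ring

/-- The commutation relation of the weighted raising and lowering operators. -/
theorem raise_lower_commutator (α : ℝ) (f : StrictPartition → ℝ) (l : StrictPartition) {K : ℕ}
    (hK : l.weight < K) :
    (∑ j ∈ range K, if l.CanRaise j then boxWeight α j *
      ∑ k ∈ range K, (if (l.raise j).CanLower k then contentMult k * f ((l.raise j).lower k) else 0)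
      else 0) =
    (∑ k ∈ range K, if l.CanLower k then contentMult k *
      ∑ j ∈ range K, (if (l.lower k).CanRaise j then boxWeight α j * f ((l.lower k).raise j) else 0)
      else 0) + (α + 4 * (l.weight : ℝ)) * f l := by
  have h1 : (∑ j ∈ range K, if l.CanRaise j then boxWeight α j *
      ∑ k ∈ range K, (if (l.raise j).CanLower k then contentMult k * f ((l.raise j).lower k) else 0)
      else 0) = ∑ j ∈ range K, ∑ k ∈ range K, boxWeight α j * contentMult k *
        (if l.CanRaise j then if (l.raise j).CanLower k then f ((l.raise j).lower k) else 0
          else 0) := by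
    refine sum_congr rfl fun j _ => ?_
    split_ifs
    · rw [mul_sum]
      refine sum_congr rfl fun k _ => ?_
      split_ifs <;> ring
    · simp
  have h2 : (∑ k ∈ range K, if l.CanLower k then contentMult k *
      ∑ j ∈ range K, (if (l.lower k).CanRaise j then boxWeight α j * f ((l.lower k).raise j) else 0)
      else 0) = ∑ j ∈ range K, ∑ k ∈ range K, boxWeight α j * contentMult k *
        (if l.CanLower k then if (l.lower k).CanRaise j then f ((l.lower k).raise j) else 0
          else 0) := by
    rw [sum_comm]
    refine sum_congr rfl fun k _ => ?_
    split_ifs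
    · rw [mul_sum]
      refine sum_congr rfl fun j _ => ?_
      split_ifs <;> ring
    · simp
  rw [h1, h2, ← sub_eq_iff_eq_add', ← sum_sub_distrib, ← sum_boxWeight_diag α l hK, sum_mul]
  refine sum_congr rfl fun j hj => ?_
  -- Different contents commute, so only `k = j` contributes, where each composition returns to `l`.
  rw [← sum_sub_distrib, sum_eq_single_of_mem j hj]
  · by_cases hr : l.CanRaise j
    · have hl : ¬ l.CanLower j := fun h => hr.2 h.1
      simp [hr, hl, hr.canLower_raise, hr.lower_raise]
    · by_cases hl : l.CanLower j
      · simp [hr, hl, hl.canRaise_lower, hl.raise_lower]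
      · simp [hr, hl]
  · intro k _ hk
    rw [raise_lower_sum_comm f l (Ne.symm hk), sub_self]

/-- The number of oriented paths from `m` to `l`. -/
noncomputable def pathCount (m l : StrictPartition) : ℝ :=
  if m.weight ≤ l.weight then (numPaths (l.weight - m.weight) m l : ℝ) else 0

theorem pathCount_of_weight_lt {m l : StrictPartition} (h : l.weight < m.weight) :
    pathCount m l = 0 := if_neg (not_le.2 h)

open Classical in
theorem pathCount_of_weight_eq {m l : StrictPartition} (h : l.weight = m.weight) :
    pathCount m l = if m = l then 1 else 0 := by
  rw [pathCount, if_pos h.ge, h, Nat.sub_self, numPaths]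
  split_ifs <;> simp

theorem pathCount_eq_sum {m l : StrictPartition} {K : ℕ} (h : m.weight < l.weight)
    (hK : l.weight ≤ K) :
    pathCount m l =
      ∑ k ∈ range K, if l.CanLower k then contentMult k * pathCount m (l.lower k) else 0 := by
  obtain ⟨d, hd⟩ := Nat.exists_eq_add_of_lt h
  have hl : l.weight - m.weight = d + 1 := by omega
  rw [pathCount, if_pos h.le, hl, numPaths]
  push_cast
  rw [sum_mul_edgeMult (n := m.weight + d) (K := K) hd (by omega) (fun v => (numPaths d m v : ℝ))]
  refine sum_congr rfl fun k _ => ?_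
  split_ifs with hk
  · have h1 := hk.weight_lower
    rw [pathCount, if_pos (by omega)]
    congr 4
    omega
  · rfl

theorem dim_eq_pathCount (l : StrictPartition) : (dim l : ℝ) = pathCount StrictPartition.empty l := by
  have h : StrictPartition.empty.weight = 0 := rfl
  rw [dim, pathCount, h, if_pos (Nat.zero_le _), Nat.sub_zero]

/-- The weighted number of pairs consisting of a path from `m` and an edge back to `l`. -/
theorem sum_boxWeight_mul_pathCount (α : ℝ) (m : StrictPartition) {K : ℕ} (l : StrictPartition)
    (hml : m.weight ≤ l.weight + 1) (hK : l.weight + 1 < K) :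
    (∑ j ∈ range K, if l.CanRaise j then boxWeight α j * pathCount m (l.raise j) else 0) =
      (∑ j ∈ range K, if m.CanLower j then boxWeight α j * pathCount (m.lower j) l else 0) +
        ((l.weight : ℝ) - m.weight + 1) * (α + 2 * ((l.weight : ℝ) + m.weight)) *
          pathCount m l := by
  induction hn : l.weight using Nat.strong_induction_on generalizing l with
  | _ n ih =>
  subst hn
  rcases Nat.lt_or_ge l.weight m.weight with hlt | hge
  -- Base case: each side is the weight of the box `m / l` if `l ↗ m`, and zero otherwise.
  · have hw : m.weight = l.weight + 1 := by omega
    rw [pathCount_of_weight_lt hlt, mul_zero, add_zero]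
    refine sum_congr rfl fun j _ => ?_
    by_cases h : l.CanRaise j ∧ m = l.raise j
    · obtain ⟨h1, rfl⟩ := h
      rw [if_pos h1, if_pos h1.canLower_raise, h1.lower_raise, pathCount_of_weight_eq rfl,
        pathCount_of_weight_eq rfl, if_pos rfl, if_pos rfl]
    · have h' : ¬ (m.CanLower j ∧ l = m.lower j) := by
        rwa [← addBox_content_iff, addBox_content_iff_raise]
      trans (0 : ℝ)
      · split_ifs with h1
        · rw [pathCount_of_weight_eq (by rw [h1.weight_raise, hw]), if_neg fun h2 => h ⟨h1, h2⟩,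
            mul_zero]
        · rfl
      · split_ifs with h1
        · have := h1.weight_lower
          rw [pathCount_of_weight_eq (by omega), if_neg fun h2 => h' ⟨h1, h2.symm⟩, mul_zero]
        · rfl
  · have h1 : (∑ j ∈ range K, if l.CanRaise j then boxWeight α j * pathCount m (l.raise j) else 0) =
        ∑ j ∈ range K, if l.CanRaise j then boxWeight α j * ∑ k ∈ range K,
          (if (l.raise j).CanLower k then contentMult k * pathCount m ((l.raise j).lower k) else 0)
          else 0 := by
      refine sum_congr rfl fun j _ => ?_
      split_ifs with h
      · have := h.weight_raise
        rw [pathCount_eq_sum (by omega) (by omega : (l.raise j).weight ≤ K)]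
      · rfl
    -- After the last edge of the path is split off, the raising step moves past it; the induction
    -- hypothesis then applies to the diagrams `l.lower k`.
    rw [h1, raise_lower_commutator α (pathCount m) l (by omega)]
    have h2 : (∑ k ∈ range K, if l.CanLower k then contentMult k * ∑ j ∈ range K,
          (if (l.lower k).CanRaise j then boxWeight α j * pathCount m ((l.lower k).raise j) else 0)
          else 0) =
        (∑ k ∈ range K, if l.CanLower k then contentMult k * ∑ j ∈ range K,
          (if m.CanLower j then boxWeight α j * pathCount (m.lower j) (l.lower k) else 0) else 0) +
        ((l.weight : ℝ) - m.weight) * (α + 2 * ((l.weight : ℝ) - 1 + m.weight)) *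
          ∑ k ∈ range K, if l.CanLower k then contentMult k * pathCount m (l.lower k) else 0 := by
      rw [mul_sum, ← sum_add_distrib]
      refine sum_congr rfl fun k _ => ?_
      split_ifs with h
      · have hw := h.weight_lower
        have hw' : (l.weight : ℝ) = (l.lower k).weight + 1 := by exact_mod_cast hw.symm
        rw [ih (l.lower k).weight (by omega) (l.lower k) (by omega) (by omega) rfl, hw']
        ring
      · simp
    have h3 : (∑ k ∈ range K, if l.CanLower k then contentMult k * ∑ j ∈ range K,
          (if m.CanLower j then boxWeight α j * pathCount (m.lower j) (l.lower k) else 0) else 0) =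
        ∑ j ∈ range K, if m.CanLower j then boxWeight α j * pathCount (m.lower j) l else 0 := by
      trans ∑ k ∈ range K, ∑ j ∈ range K, if l.CanLower k then if m.CanLower j then
          contentMult k * (boxWeight α j * pathCount (m.lower j) (l.lower k)) else 0 else 0
      · refine sum_congr rfl fun k _ => ?_
        split_ifs
        · rw [mul_sum]
          refine sum_congr rfl fun j _ => ?_
          split_ifs <;> ring
        · simp
      · rw [sum_comm]
        refine sum_congr rfl fun j _ => ?_
        split_ifs with h
        · have := h.weight_lower
          rw [pathCount_eq_sum (by omega) (by omega : l.weight ≤ K), mul_sum]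
          refine sum_congr rfl fun k _ => ?_
          split_ifs <;> ring
        · simp
    rw [h2, h3]
    -- If the weights are equal, the recursion for `pathCount m l` is not available, but its
    -- coefficient vanishes. Otherwise, with `d = |l| - |m|`, the constants match by `d (α + 2 (|l|
    -- - 1 + |m|)) + α + 4 |l| = (d + 1) (α + 2 (|l| + |m|))`.
    rcases hge.eq_or_lt with heq | hlt
    · rw [heq]
      ring
    · rw [← pathCount_eq_sum hlt (by omega)]
      ring

end SchurGraph

/-! ### Interpolation and product identities -/

/-- The coefficient comparison in Lagrange interpolation for `∏ (X - b_j) - ∏ (X - a_j)`. -/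
theorem Lagrange.sum_prod_sub_div {ι : Type*} [DecidableEq ι] (s : Finset ι) (a b : ι → ℝ)
    (ha : Set.InjOn a s) :
    ∑ k ∈ s, (a k - b k) * ∏ j ∈ s.erase k, (a k - b j) / (a k - a j) = ∑ k ∈ s, (a k - b k) := by
  rcases s.eq_empty_or_nonempty with rfl | hs
  · simp
  set P : Polynomial ℝ := nodal s b - nodal s a with hP
  have hdeg : P.degree < #s := by
    rw [← degree_nodal (s := s) (v := b)]
    refine Polynomial.degree_sub_lt_left ?_ nodal_ne_zero ?_
    · rw [degree_nodal, degree_nodal]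
    · rw [nodal_monic.leadingCoeff, nodal_monic.leadingCoeff]
  have h := coeff_eq_sum ha hdeg
  have hc : P.coeff (#s - 1) = ∑ k ∈ s, (a k - b k) := by
    rw [hP, Polynomial.coeff_sub, nodal_eq, nodal_eq,
      Polynomial.prod_X_sub_C_coeff_card_pred _ _ hs.card_pos,
      Polynomial.prod_X_sub_C_coeff_card_pred _ _ hs.card_pos, sum_sub_distrib]
    ring
  rw [← hc, h]
  refine sum_congr rfl fun k hk => ?_
  rw [hP, Polynomial.eval_sub, eval_nodal_at_node hk, eval_nodal, sub_zero, prod_div_distrib,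
    ← mul_prod_erase s _ hk, mul_div_assoc]

/-- This is interpolation with nodes `a = z (z - 1)` and `b = z (z + 1)`: `a_k - a_j = (z_k -
z_j)(z_k + z_j - 1)`, `a_k - b_j = (z_k + z_j)(z_k - z_j - 1)` and `a_k - b_k = -2 z_k`. The nodes
are distinct because `z_i + z_j = 1` is impossible for positive integers. -/
theorem sum_mul_prod_lower_ratio {ι : Type*} [DecidableEq ι] (s : Finset ι) (z : ι → ℕ)
    (hz : Set.InjOn z s) (hpos : ∀ i ∈ s, 0 < z i) :
    ∑ k ∈ s, (z k : ℝ) * ∏ j ∈ s.erase k,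
      (((z k : ℝ) - 1 - z j) * (z k + z j)) / ((z k - 1 + z j) * (z k - z j)) =
      ∑ k ∈ s, (z k : ℝ) := by
  have h := Lagrange.sum_prod_sub_div s (fun i => (z i : ℝ) * (z i - 1))
    (fun i => (z i : ℝ) * (z i + 1)) (by
      intro i hi j hj hij
      apply hz hi hj
      have h1 : (1 : ℝ) ≤ z i := by exact_mod_cast hpos i hi
      have h2 : (1 : ℝ) ≤ z j := by exact_mod_cast hpos j hj
      simp only at hij
      by_contra hne
      have h3 : (z i : ℝ) - z j ≠ 0 := sub_ne_zero.2 (by exact_mod_cast hne)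
      have h4 : ((z i : ℝ) - z j) * (z i + z j - 1) = 0 := by linear_combination hij
      have h5 := (mul_eq_zero.1 h4).resolve_left h3
      have h6 : z i = 1 := by
        have : (z i : ℝ) = 1 := by linarith
        exact_mod_cast this
      have h7 : z j = 1 := by
        have : (z j : ℝ) = 1 := by linarith
        exact_mod_cast this
      exact hne (h6.trans h7.symm))
  have h2 : ∀ x : ℝ, x * (x - 1) - x * (x + 1) = -2 * x := fun x => by ring
  simp only [h2, mul_assoc, ← mul_sum] at h
  have h := mul_left_cancel₀ (by norm_num) h
  rw [← h]
  refine sum_congr rfl fun k _ => ?_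
  congr 1
  refine prod_congr rfl fun j _ => ?_
  congr 1 <;> ring

/-- A product over pairs whose factors are trivial unless one of the indices is `k`. -/
theorem Fin.prod_pairs_eq_prod_erase {N : ℕ} (k : Fin N) (r : Fin N → Fin N → ℝ)
    (hs : ∀ i j, r i j = r j i) (h1 : ∀ i j, i ≠ k → j ≠ k → r i j = 1) :
    ∏ p : Fin N × Fin N with p.1 < p.2, r p.1 p.2 = ∏ j ∈ univ.erase k, r k j := by
  have hr : ∀ j, r (min j k) (max j k) = r k j := by
    intro j
    rcases le_total j k with h | h
    · rw [min_eq_left h, max_eq_right h, hs]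
    · rw [min_eq_right h, max_eq_left h]
  symm
  refine prod_bij_ne_one (fun j _ _ => (min j k, max j k)) ?_ ?_ ?_ ?_
  · intro j hj _
    have : k ≠ j := (mem_erase.1 hj).1.symm
    simp [this]
  · intro i hi _ j hj _ h
    simp only [Prod.mk.injEq] at h
    rcases le_total i k with h1 | h1 <;> rcases le_total j k with h2 | h2 <;>
      simp only [h1, h2, min_eq_left, min_eq_right, max_eq_left, max_eq_right] at h <;>
      aesop
  · rintro ⟨i, j⟩ hp hne
    have hij : i < j := by simpa using hp
    have hor : i = k ∨ j = k := by
      by_contra hcon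
      push Not at hcon
      exact hne (h1 i j hcon.1 hcon.2)
    rcases hor with rfl | rfl
    · refine ⟨j, mem_erase.2 ⟨hij.ne', mem_univ _⟩, hne, ?_⟩
      simp [hij.le]
    · refine ⟨i, mem_erase.2 ⟨hij.ne, mem_univ _⟩, ?_, ?_⟩
      · rwa [hs]
      · simp [hij.le]
  · intro j _ _
    exact (hr j).symm

/-- Both factorisations of $z^{\downarrow(a+1)}$ are compared: $z\,(z-1)^{\downarrow
a}=z^{\downarrow a}(z-a)$. -/
theorem descPochhammer_eval_pred_div_factorial (a z : ℕ) (hz : 0 < z) :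
    (descPochhammer ℝ a).eval ((z - 1 : ℕ) : ℝ) / ((z - 1).factorial : ℝ) =
      ((z : ℝ) - a) * ((descPochhammer ℝ a).eval (z : ℝ) / (z.factorial : ℝ)) := by
  obtain ⟨t, rfl⟩ := Nat.exists_eq_add_of_lt hz
  simp only [zero_add, Nat.add_sub_cancel]
  have h1 := descPochhammer_succ_eval a ((t + 1 : ℕ) : ℝ)
  rw [descPochhammer_succ_left] at h1
  simp only [Polynomial.eval_mul, Polynomial.eval_X, Polynomial.eval_comp, Polynomial.eval_sub,
    Polynomial.eval_one] at h1
  have h2 : ((t + 1 : ℕ) : ℝ) - 1 = t := by push_cast; ring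
  rw [h2] at h1
  have h3 : (t.factorial : ℝ) ≠ 0 := by exact_mod_cast t.factorial_ne_zero
  have h4 : ((t + 1 : ℕ) : ℝ) ≠ 0 := by exact_mod_cast t.succ_ne_zero
  rw [Nat.factorial_succ, Nat.cast_mul]
  field_simp
  linear_combination h1

/-! ### Product weights, alternating sums and lowering of variables -/

namespace SchurGraph
open StrictPartition

/-- `∏ 1/y_i! ∏_{i < j} (y_i - y_j)/(y_i + y_j)`. -/
noncomputable def dimWeight {N : ℕ} (y : Fin N → ℕ) : ℝ :=
  (∏ i, 1 / ((y i).factorial : ℝ)) *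
    ∏ p : Fin N × Fin N with p.1 < p.2, ((y p.1 : ℝ) - y p.2) / (y p.1 + y p.2)

/-- The product of `dimWeight` and `factorialR`, in the form without singularities. -/
noncomputable def regularTerm (m : StrictPartition) {N : ℕ} (z : Fin N → ℕ) : ℝ :=
  (∏ i : Fin N, (if i.val < m.length then (descPochhammer ℝ (m.part i)).eval (z i : ℝ) else 1) /
      ((z i).factorial : ℝ)) *
    ∏ p : Fin N × Fin N with p.1 < p.2 ∧ ¬ p.1.val < m.length,
      ((z p.1 : ℝ) - z p.2) / (z p.1 + z p.2)

theorem regularTerm_empty {N : ℕ} (z : Fin N → ℕ) :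
    regularTerm StrictPartition.empty z = dimWeight z := by
  have h : StrictPartition.empty.length = 0 := rfl
  simp [regularTerm, dimWeight, h]

/-- The pair factors of `regularTerm` involve only indices at least `ℓ(m)`, so the variable `z k`
enters through its single factor alone. -/
theorem regularTerm_update_of_lt (m : StrictPartition) {N : ℕ} (z : Fin N → ℕ) {k : Fin N}
    (hk : k.val < m.length) (hz : 0 < z k) :
    regularTerm m (Function.update z k (z k - 1)) =
      ((z k : ℝ) - m.part k) * regularTerm m z := by
  unfold regularTerm
  rw [← mul_prod_erase univ _ (mem_univ k), ← mul_prod_erase univ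
    (fun i : Fin N => (if i.val < m.length then (descPochhammer ℝ (m.part i)).eval (z i : ℝ) else 1) /
      ((z i).factorial : ℝ)) (mem_univ k), Function.update_self, if_pos hk, if_pos hk,
    descPochhammer_eval_pred_div_factorial _ _ hz]
  have h1 : ∀ i ∈ univ.erase k, Function.update z k (z k - 1) i = z i := fun i hi =>
    Function.update_of_ne (mem_erase.1 hi).1 _ _
  rw [prod_congr rfl fun i hi => by rw [h1 i hi]]
  have h2 : ∀ p ∈ (univ : Finset (Fin N × Fin N)).filter
      (fun p => p.1 < p.2 ∧ ¬ p.1.val < m.length), p.1 ≠ k ∧ p.2 ≠ k := by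
    rintro ⟨i, j⟩ hp
    obtain ⟨hij, hi⟩ := (mem_filter.1 hp).2
    simp only at hij hi
    constructor
    · rintro rfl; exact hi hk
    · rintro rfl; exact hi (lt_trans hij hk)
  rw [prod_congr (s₁ := (univ : Finset (Fin N × Fin N)).filter
      (fun p => p.1 < p.2 ∧ ¬ p.1.val < m.length)) rfl fun p hp => by
    rw [Function.update_of_ne (h2 p hp).1, Function.update_of_ne (h2 p hp).2]]
  ring

/-- The factor `z k` comes from the factorial, and each pair containing `k` contributes the ratio of
its new and old factors. These ratios add up by `sum_mul_prod_lower_ratio`. -/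
theorem regularTerm_update_of_le (m : StrictPartition) {N : ℕ} (z : Fin N → ℕ) {k : Fin N}
    (hk : m.length ≤ k.val) (hinj : Function.Injective z) (hz : ∀ i, 0 < z i) :
    regularTerm m (Function.update z k (z k - 1)) =
      ((z k : ℝ) * ∏ j ∈ (univ.filter fun i : Fin N => m.length ≤ i.val).erase k,
        (((z k : ℝ) - 1 - z j) * (z k + z j)) / ((z k - 1 + z j) * (z k - z j))) *
      regularTerm m z := by
  unfold regularTerm
  rw [← mul_prod_erase univ _ (mem_univ k), ← mul_prod_erase univ
    (fun i : Fin N => (if i.val < m.length then (descPochhammer ℝ (m.part i)).eval (z i : ℝ) else 1) /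
      ((z i).factorial : ℝ)) (mem_univ k), Function.update_self, if_neg (not_lt.2 hk),
    if_neg (not_lt.2 hk)]
  have h1 : ∀ i ∈ univ.erase k, Function.update z k (z k - 1) i = z i := fun i hi =>
    Function.update_of_ne (mem_erase.1 hi).1 _ _
  rw [prod_congr rfl fun i hi => by rw [h1 i hi]]
  have hfac : 1 / ((z k - 1).factorial : ℝ) = z k * (1 / ((z k).factorial : ℝ)) := by
    have h3 : ((z k - 1).factorial : ℝ) ≠ 0 := by exact_mod_cast (z k - 1).factorial_ne_zero
    have h4 : (z k : ℝ) ≠ 0 := by exact_mod_cast (hz k).ne'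
    rw [← Nat.mul_factorial_pred (hz k).ne']
    push_cast
    field_simp
  set c : Fin N → ℝ := fun j =>
    (((z k : ℝ) - 1 - z j) * (z k + z j)) / ((z k - 1 + z j) * (z k - z j)) with hc
  -- The ratio of the new and old pair factors. It does not depend on the order of the pair, since
  -- both factors change sign together.
  set r : Fin N → Fin N → ℝ := fun i j => if m.length ≤ i.val ∧ m.length ≤ j.val then
    (if i = k then c j else if j = k then c i else 1) else 1 with hr
  have hpair : ∏ p : Fin N × Fin N with p.1 < p.2 ∧ ¬ p.1.val < m.length,
      ((Function.update z k (z k - 1) p.1 : ℝ) - Function.update z k (z k - 1) p.2) /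
        (Function.update z k (z k - 1) p.1 + Function.update z k (z k - 1) p.2) =
      (∏ j ∈ (univ.filter fun i : Fin N => m.length ≤ i.val).erase k, c j) *
      ∏ p : Fin N × Fin N with p.1 < p.2 ∧ ¬ p.1.val < m.length,
        ((z p.1 : ℝ) - z p.2) / (z p.1 + z p.2) := by
    have e1 : ∏ j ∈ (univ.filter fun i : Fin N => m.length ≤ i.val).erase k, c j =
        ∏ p : Fin N × Fin N with p.1 < p.2 ∧ ¬ p.1.val < m.length, r p.1 p.2 := by
      trans ∏ p : Fin N × Fin N with p.1 < p.2, r p.1 p.2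
      · rw [Fin.prod_pairs_eq_prod_erase k r]
        · refine (prod_congr rfl fun j hj => ?_).trans (prod_subset (erase_subset_erase k
            (subset_univ _)) fun j hj hj' => ?_)
          · simp [hr, hk, (mem_filter.1 (mem_erase.1 hj).2).2]
          · have : ¬ m.length ≤ j.val := fun h =>
              hj' (mem_erase.2 ⟨(mem_erase.1 hj).1, mem_filter.2 ⟨mem_univ _, h⟩⟩)
            simp [hr, this]
        · intro i j
          simp only [hr, and_comm]
          split_ifs <;> simp_all
        · intro i j hi hj
          simp [hr, hi, hj]
      · rw [← filter_filter]
        symm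
        refine prod_filter_of_ne fun p _ hne => ?_
        by_contra hcon
        apply hne
        simp only [hr]
        rw [if_neg (by omega)]
    rw [e1, ← prod_mul_distrib]
    refine prod_congr rfl fun p hp => ?_
    obtain ⟨hij, hi⟩ := (mem_filter.1 hp).2
    obtain ⟨i, j⟩ := p
    simp only at hij hi ⊢
    have hi' : m.length ≤ i.val := not_lt.1 hi
    have hj' : m.length ≤ j.val := hi'.trans hij.le
    have hpred : ((z k - 1 : ℕ) : ℝ) = z k - 1 := by
      rw [Nat.cast_sub (hz k), Nat.cast_one]
    have hzr : ∀ i, (1 : ℝ) ≤ z i := fun i => by exact_mod_cast hz i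
    have hne : ∀ i j, i ≠ j → (z i : ℝ) - z j ≠ 0 := fun i j h =>
      sub_ne_zero.2 (by exact_mod_cast hinj.ne h)
    simp only [hr, hi', hj', and_self, if_true]
    have hsum : (z i : ℝ) + z j ≠ 0 := by linarith [hzr i, hzr j]
    have hne' := hne i j hij.ne
    by_cases hik : i = k
    · subst hik
      have hji : j ≠ i := hij.ne'
      rw [Function.update_self, Function.update_of_ne hji, if_pos rfl, hpred]
      have : (z i : ℝ) - 1 + z j ≠ 0 := by linarith [hzr i, hzr j]
      simp only [hc]
      field_simp
    · rw [if_neg hik, Function.update_of_ne hik]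
      by_cases hjk : j = k
      · subst hjk
        rw [Function.update_self, if_pos rfl, hpred]
        have : (z j : ℝ) - 1 + z i ≠ 0 := by linarith [hzr i, hzr j]
        have h5 : (z i : ℝ) + (z j - 1) ≠ 0 := by linarith [hzr i, hzr j]
        have h6 := hne j i (Ne.symm hij.ne)
        simp only [hc]
        rw [div_mul_div_comm, div_eq_div_iff h5 (by positivity)]
        ring
      · rw [if_neg hjk, Function.update_of_ne hjk, one_mul]
  rw [hpair, hfac]
  ring

theorem sum_part_eq_weight (m : StrictPartition) {N : ℕ} (hN : m.length ≤ N) :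
    ∑ i : Fin N, m.part i = m.weight := by
  rw [Fin.sum_univ_eq_sum_range m.part N, weight, ← sum_subset (range_subset_range.2 hN)
    fun i _ hi => m.part_of_length_le (not_lt.1 fun h => hi (mem_range.2 h)),
    ← Fin.sum_univ_eq_sum_range]
  exact (Finset.sum_congr rfl fun i _ => m.part_eq_getElem i.2).trans (Fin.sum_univ_getElem _)

/-- Lowering one variable at a time multiplies `regularTerm` by the difference of weights. -/
theorem sum_regularTerm_update (m : StrictPartition) {N : ℕ} (z : Fin N → ℕ)
    (hinj : Function.Injective z) (hz : ∀ i, 0 < z i) (hN : m.length ≤ N) :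
    ∑ k, regularTerm m (Function.update z k (z k - 1)) =
      ((∑ i, (z i : ℝ)) - m.weight) * regularTerm m z := by
  have hw : (m.weight : ℝ) = ∑ i : Fin N with ¬ m.length ≤ i.val, (m.part i : ℝ) := by
    rw [← sum_part_eq_weight m hN, Nat.cast_sum]
    symm
    refine sum_filter_of_ne fun i _ hi h => hi ?_
    rw [m.part_of_length_le h, Nat.cast_zero]
  rw [← sum_filter_add_sum_filter_not univ (fun i : Fin N => m.length ≤ i.val),
    sum_congr rfl fun k hk => regularTerm_update_of_le m z (mem_filter.1 hk).2 hinj hz,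
    sum_congr (s₁ := univ.filter fun i : Fin N => ¬ m.length ≤ i.val) rfl fun k hk =>
      regularTerm_update_of_lt m z (not_le.1 (mem_filter.1 hk).2) (hz k), ← sum_mul, ← sum_mul,
    sum_mul_prod_lower_ratio _ z hinj.injOn fun i _ => hz i, sum_sub_distrib, hw,
    ← sum_filter_add_sum_filter_not univ (fun i : Fin N => m.length ≤ i.val)
      (fun i => (z i : ℝ))]
  ring

theorem dimWeight_comp_perm {N : ℕ} (y : Fin N → ℕ) (w : Equiv.Perm (Fin N)) :
    dimWeight (y ∘ w) = (Equiv.Perm.sign w : ℤ) * dimWeight y := by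
  have h : ∀ f : Fin N → Fin N → ℝ, ∏ p : Fin N × Fin N with p.1 < p.2, f p.1 p.2 =
      ∏ i, ∏ j ∈ Ioi i, f i j := by
    intro f
    rw [prod_filter, Fintype.prod_prod_type]
    refine prod_congr rfl fun i _ => ?_
    rw [← prod_filter]
    congr 1
    ext j
    simp
  unfold dimWeight
  rw [h (fun i j => ((y i : ℝ) - y j) / (y i + y j)),
    h (fun i j => (((y ∘ w) i : ℝ) - (y ∘ w) j) / ((y ∘ w) i + (y ∘ w) j))]
  simp only [Function.comp_apply]
  rw [w.prod_Ioi_comp_eq_sign_mul_prod (f := fun i j => ((y i : ℝ) - y j) / (y i + y j)),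
    Equiv.prod_comp w (fun i => 1 / ((y i).factorial : ℝ))]
  · ring
  · intro i j
    rw [← neg_sub, neg_div, add_comm]

/-- The factors `(z_i + z_j)/(z_i - z_j)` with `i < ℓ(m)` cancel against those of `dimWeight`. The
result no longer has differences in denominators, so it remains meaningful when lowering makes two
variables equal. -/
theorem dimWeight_mul_factorialR (m : StrictPartition) {N : ℕ} (z : Fin N → ℕ)
    (hinj : Function.Injective z) :
    dimWeight z * factorialR m N (fun i => (z i : ℝ)) = regularTerm m z := by
  unfold dimWeight factorialR regularTerm
  have h1 : ∏ p : Fin N × Fin N with p.1 < p.2, ((z p.1 : ℝ) - z p.2) / (z p.1 + z p.2) =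
      (∏ p : Fin N × Fin N with p.1.val < m.length ∧ p.1 < p.2,
        ((z p.1 : ℝ) - z p.2) / (z p.1 + z p.2)) *
      ∏ p : Fin N × Fin N with p.1 < p.2 ∧ ¬ p.1.val < m.length,
        ((z p.1 : ℝ) - z p.2) / (z p.1 + z p.2) := by
    rw [← prod_filter_mul_prod_filter_not (univ.filter fun p : Fin N × Fin N => p.1 < p.2)
      (fun p => p.1.val < m.length), filter_filter, filter_filter]
    simp_rw [and_comm]
  have h2 : (∏ p : Fin N × Fin N with p.1.val < m.length ∧ p.1 < p.2,
        ((z p.1 : ℝ) - z p.2) / (z p.1 + z p.2)) *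
      (∏ p : Fin N × Fin N with p.1.val < m.length ∧ p.1 < p.2,
        ((z p.1 : ℝ) + z p.2) / (z p.1 - z p.2)) = 1 := by
    rw [← prod_mul_distrib]
    refine prod_eq_one fun p hp => ?_
    have hne : z p.1 ≠ z p.2 := hinj.ne (mem_filter.1 hp).2.2.ne
    have h3 : (z p.1 : ℝ) - z p.2 ≠ 0 := sub_ne_zero.2 (by exact_mod_cast hne)
    have h4 : (z p.1 : ℝ) + z p.2 ≠ 0 := by
      have : z p.1 + z p.2 ≠ 0 := by omega
      exact_mod_cast this
    field_simp
  rw [h1, prod_filter (fun i : Fin N => i.val < m.length)]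
  rw [prod_congr (g := fun i : Fin N => (if i.val < m.length then
      (descPochhammer ℝ (m.part i)).eval (z i : ℝ) else 1) * (1 / ((z i).factorial : ℝ)))
    (s₂ := univ) rfl fun i _ => div_eq_mul_one_div _ _, prod_mul_distrib]
  linear_combination (∏ i, 1 / ((z i).factorial : ℝ)) *
    (∏ i : Fin N, if i.val < m.length then (descPochhammer ℝ (m.part i)).eval (z i : ℝ) else 1) *
    (∏ p : Fin N × Fin N with p.1 < p.2 ∧ ¬ p.1.val < m.length,
        ((z p.1 : ℝ) - z p.2) / (z p.1 + z p.2)) * h2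

/-- The alternating sum over the permutations of the variables of `regularTerm`. -/
noncomputable def altSum (m : StrictPartition) {N : ℕ} (y : Fin N → ℕ) : ℝ :=
  ∑ w : Equiv.Perm (Fin N), ((Equiv.Perm.sign w : ℤ) : ℝ) * regularTerm m (y ∘ w)

theorem altSum_eq_zero (m : StrictPartition) {N : ℕ} (y : Fin N → ℕ)
    (hy : ¬ Function.Injective y) : altSum m y = 0 := by
  simp only [Function.Injective, not_forall] at hy
  obtain ⟨i, j, hij, hne⟩ := hy
  have hs : y ∘ Equiv.swap i j = y := by
    ext a
    simp only [Function.comp_apply]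
    by_cases h1 : a = i
    · subst h1; simp [hij]
    · by_cases h2 : a = j
      · subst h2; simp [hij]
      · rw [Equiv.swap_apply_of_ne_of_ne h1 h2]
  -- Composition with the transposition of the two equal variables reverses the sign and preserves
  -- the term.
  refine sum_involution (fun w _ => Equiv.swap i j * w) ?_ ?_ (fun _ _ => mem_univ _) ?_
  · intro w _
    have : y ∘ (Equiv.swap i j * w : Equiv.Perm (Fin N)) = y ∘ w := by
      rw [Equiv.Perm.coe_mul, ← Function.comp_assoc, hs]
    rw [this, Equiv.Perm.sign_mul, Equiv.Perm.sign_swap hne]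
    simp
  · intro w _ _ h
    have h1 := congrArg Equiv.Perm.sign h
    rw [Equiv.Perm.sign_mul, Equiv.Perm.sign_swap hne] at h1
    simp at h1
  · intro w _
    simp

theorem dimWeight_eq_zero {N : ℕ} (y : Fin N → ℕ) (hy : ¬ Function.Injective y) :
    dimWeight y = 0 := by
  simp only [Function.Injective, not_forall] at hy
  obtain ⟨i, j, hij, hne⟩ := hy
  unfold dimWeight
  apply mul_eq_zero_of_right
  rcases lt_or_gt_of_ne hne with h | h
  · exact prod_eq_zero (i := (i, j)) (by simp [h]) (by simp [hij])
  · exact prod_eq_zero (i := (j, i)) (by simp [h]) (by simp [hij])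

/-- `dimWeight` is antisymmetric, which turns the symmetrisation into an alternating sum. No
injectivity of `y` is needed: at coinciding variables both sides vanish, whatever value the division
by zero gives to `factorialQ`. -/
theorem dimWeight_mul_factorialQ (m : StrictPartition) {N : ℕ} (hN : m.length ≤ N)
    (y : Fin N → ℕ) :
    dimWeight y * factorialQ m N (fun i => (y i : ℝ)) =
      (2 : ℝ) ^ m.length / ((N - m.length).factorial : ℝ) * altSum m y := by
  by_cases hy : Function.Injective y
  · rw [factorialQ, if_pos hN, altSum, mul_left_comm, mul_sum]
    congr 1
    refine sum_congr rfl fun w _ => ?_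
    rw [← dimWeight_mul_factorialR m (y ∘ w) (hy.comp w.injective), dimWeight_comp_perm,
      ← mul_assoc, ← mul_assoc, ← Int.cast_mul]
    have : ((Equiv.Perm.sign w : ℤ) * (Equiv.Perm.sign w : ℤ)) = 1 := by
      rw [← Units.val_mul, Int.units_mul_self, Units.val_one]
    rw [this, Int.cast_one, one_mul]
    rfl
  · rw [dimWeight_eq_zero y hy, altSum_eq_zero m y hy, zero_mul, mul_zero]

theorem sum_altSum_update (m : StrictPartition) {N : ℕ} (y : Fin N → ℕ)
    (hinj : Function.Injective y) (hy : ∀ i, 0 < y i) (hN : m.length ≤ N) :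
    ∑ k, altSum m (Function.update y k (y k - 1)) =
      ((∑ i, (y i : ℝ)) - m.weight) * altSum m y := by
  unfold altSum
  rw [sum_comm, mul_sum]
  refine sum_congr rfl fun w _ => ?_
  have h := sum_regularTerm_update m (y ∘ w) (hinj.comp w.injective) (fun i => hy (w i)) hN
  have h1 : ∑ i, ((y ∘ w) i : ℝ) = ∑ i, (y i : ℝ) := Equiv.sum_comp w (fun i => (y i : ℝ))
  rw [h1] at h
  rw [← mul_sum, mul_left_comm, ← h]
  congr 1
  -- Lowering the variable `w k` of `y` is lowering the variable `k` of `y ∘ w`.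
  rw [← Equiv.sum_comp w]
  refine sum_congr rfl fun k _ => ?_
  rw [Function.update_comp_equiv]
  simp

theorem sum_dimWeight_mul_factorialQ_update (m : StrictPartition) {N : ℕ} (y : Fin N → ℕ)
    (hinj : Function.Injective y) (hy : ∀ i, 0 < y i) :
    ∑ k, dimWeight (Function.update y k (y k - 1)) *
        factorialQ m N (fun i => (Function.update y k (y k - 1) i : ℝ)) =
      ((∑ i, (y i : ℝ)) - m.weight) * (dimWeight y * factorialQ m N (fun i => (y i : ℝ))) := by
  by_cases hN : m.length ≤ N
  · simp_rw [dimWeight_mul_factorialQ m hN]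
    rw [← mul_sum, sum_altSum_update m y hinj hy hN]
    ring
  · simp [factorialQ, hN]

theorem sum_dimWeight_update {N : ℕ} (y : Fin N → ℕ)
    (hinj : Function.Injective y) (hy : ∀ i, 0 < y i) :
    ∑ k, dimWeight (Function.update y k (y k - 1)) = (∑ i, (y i : ℝ)) * dimWeight y := by
  have h := sum_regularTerm_update StrictPartition.empty y hinj hy (Nat.zero_le _)
  simp_rw [regularTerm_empty] at h
  have hw : StrictPartition.empty.weight = 0 := rfl
  rw [h, hw, Nat.cast_zero, sub_zero]

end SchurGraph

/-! ### Stability under adding a zero variable -/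

/-- The permutation of `Fin (N + 1)` that maps `p` to the last element and acts on the remaining
elements, in their order, as `e`. -/
def Fin.permInsertLast {N : ℕ} (x : Fin (N + 1) × Equiv.Perm (Fin N)) :
    Equiv.Perm (Fin (N + 1)) :=
  (finSuccEquiv' x.1).trans ((Equiv.optionCongr x.2).trans (finSuccEquiv' (Fin.last N)).symm)

theorem Fin.permInsertLast_self {N : ℕ} (x : Fin (N + 1) × Equiv.Perm (Fin N)) :
    Fin.permInsertLast x x.1 = Fin.last N := by
  simp [Fin.permInsertLast]

theorem Fin.permInsertLast_succAbove {N : ℕ} (x : Fin (N + 1) × Equiv.Perm (Fin N)) (i : Fin N) :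
    Fin.permInsertLast x (x.1.succAbove i) = (x.2 i).castSucc := by
  simp [Fin.permInsertLast]

theorem Fin.permInsertLast_bijective (N : ℕ) :
    Function.Bijective (Fin.permInsertLast (N := N)) := by
  rw [Fintype.bijective_iff_injective_and_card]
  constructor
  · rintro ⟨p, e⟩ ⟨q, f⟩ h
    have hpq : p = q := by
      apply (Fin.permInsertLast (q, f)).injective
      rw [← h]
      exact (Fin.permInsertLast_self (p, e)).trans
        ((congrArg (fun w => w q) h).trans (Fin.permInsertLast_self (q, f))).symm
    subst hpq
    refine Prod.ext rfl (Equiv.ext fun i => ?_)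
    apply Fin.castSucc_injective
    exact (Fin.permInsertLast_succAbove (p, e) i).symm.trans
      ((congrArg (fun w => w (p.succAbove i)) h).trans (Fin.permInsertLast_succAbove (p, f) i))
  · rw [Fintype.card_prod, Fintype.card_perm, Fintype.card_perm, Fintype.card_fin,
      Fintype.card_fin, Nat.factorial_succ]

namespace SchurGraph
open StrictPartition

theorem factorialR_insertNth_of_lt (m : StrictPartition) {N : ℕ} (z : Fin N → ℝ)
    (p : Fin (N + 1)) (hp : p.val < m.length) :
    factorialR m (N + 1) (p.insertNth (α := fun _ => ℝ) 0 z) = 0 := by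
  unfold factorialR
  apply mul_eq_zero_of_left
  refine prod_eq_zero (i := p) (by simp [hp]) ?_
  rw [Fin.insertNth_apply_same, descPochhammer_eval_zero, if_neg (m.part_pos hp).ne']

theorem factorialR_insertNth_of_le (m : StrictPartition) {N : ℕ} (z : Fin N → ℝ)
    (hz : ∀ i, z i ≠ 0) (p : Fin (N + 1)) (hp : m.length ≤ p.val) :
    factorialR m (N + 1) (p.insertNth (α := fun _ => ℝ) 0 z) = factorialR m N z := by
  have hs : ∀ i : Fin N, (p.succAbove i).val < m.length ↔ i.val < m.length := by
    intro i
    rcases lt_or_ge i.castSucc p with h | h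
    · rw [Fin.succAbove_of_castSucc_lt _ _ h, Fin.val_castSucc]
    · rw [Fin.succAbove_of_le_castSucc _ _ h, Fin.val_succ]
      have : p.val ≤ i.val := h
      omega
  have hv : ∀ i : Fin N, (p.succAbove i).val < m.length → (p.succAbove i).val = i.val := by
    intro i hi
    rcases lt_or_ge i.castSucc p with h | h
    · rw [Fin.succAbove_of_castSucc_lt _ _ h, Fin.val_castSucc]
    · rw [Fin.succAbove_of_le_castSucc _ _ h, Fin.val_succ] at hi
      have : p.val ≤ i.val := h
      omega
  unfold factorialR
  congr 1
  · rw [prod_filter, prod_filter, Fin.prod_univ_succAbove _ p, if_neg (not_lt.2 hp), one_mul]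
    refine prod_congr rfl fun i _ => ?_
    rw [Fin.insertNth_apply_succAbove]
    by_cases h : (p.succAbove i).val < m.length
    · rw [if_pos h, if_pos ((hs i).1 h), hv i h]
    · rw [if_neg h, if_neg (mt (hs i).2 h)]
  · rw [prod_filter, prod_filter, Fintype.prod_prod_type, Fintype.prod_prod_type,
      Fin.prod_univ_succAbove _ p]
    simp only [not_lt.2 hp, false_and, if_false, prod_const_one, one_mul]
    refine prod_congr rfl fun i _ => ?_
    rw [Fin.prod_univ_succAbove _ p]
    simp only [Fin.insertNth_apply_succAbove, Fin.insertNth_apply_same, add_zero, sub_zero,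
      div_self (hz i), ite_self, one_mul, hs, Fin.succAbove_lt_succAbove_iff]

/-- Stability of the factorial Schur Q-functions. -/
theorem factorialQ_snoc_zero (m : StrictPartition) {N : ℕ} (y : Fin N → ℝ) (hy : ∀ i, y i ≠ 0) :
    factorialQ m (N + 1) (Fin.snoc (α := fun _ => ℝ) y 0) = factorialQ m N y := by
  unfold factorialQ
  rw [← (Fin.permInsertLast_bijective N).sum_comp, Fintype.sum_prod_type]
  -- A permutation of the `N + 1` variables is the position `p` of the zero variable and a
  -- permutation of the others. For `p < ℓ(m)` the term contains $0^{\downarrow m_p}=0$; for the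
  -- other `N + 1 - ℓ(m)` positions the zero has no effect, as `(y + 0)/(y - 0) = 1`. This number of
  -- positions accounts for the change of the factorial.
  have hcomp : ∀ (p : Fin (N + 1)) (e : Equiv.Perm (Fin N)),
      (Fin.snoc (α := fun _ => ℝ) y 0) ∘ Fin.permInsertLast (p, e) =
        p.insertNth (α := fun _ => ℝ) 0 (y ∘ e) := by
    intro p e
    ext i
    rcases Fin.eq_self_or_eq_succAbove p i with rfl | ⟨j, rfl⟩
    · have h := Fin.permInsertLast_self (i, e)
      simp only at h
      rw [Function.comp_apply, h, Fin.snoc_last, Fin.insertNth_apply_same]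
    · have h := Fin.permInsertLast_succAbove (p, e) j
      simp only at h
      rw [Function.comp_apply, h, Fin.snoc_castSucc, Fin.insertNth_apply_succAbove,
        Function.comp_apply]
  have hR : ∀ (p : Fin (N + 1)) (e : Equiv.Perm (Fin N)),
      factorialR m (N + 1) ((Fin.snoc (α := fun _ => ℝ) y 0) ∘ Fin.permInsertLast (p, e)) =
        if m.length ≤ p.val then factorialR m N (y ∘ e) else 0 := by
    intro p e
    rw [hcomp]
    split_ifs with hp
    · exact factorialR_insertNth_of_le m _ (fun i => hy _) p hp
    · exact factorialR_insertNth_of_lt m _ p (not_le.1 hp)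
  simp_rw [hR]
  rcases Nat.lt_or_ge N m.length with hN | hN
  · rw [if_neg (by omega : ¬ m.length ≤ N)]
    split_ifs with h
    · apply mul_eq_zero_of_right
      refine sum_eq_zero fun p _ => sum_eq_zero fun e _ => if_neg ?_
      have := p.2
      omega
    · rfl
  · rw [if_pos hN, if_pos (by omega)]
    have h1 : ∀ p : Fin (N + 1), (∑ e : Equiv.Perm (Fin N),
        if m.length ≤ p.val then factorialR m N (y ∘ e) else 0) =
        if m.length ≤ p.val then ∑ e : Equiv.Perm (Fin N), factorialR m N (y ∘ e) else 0 := by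
      intro p
      split_ifs <;> simp
    simp_rw [h1]
    rw [Fin.sum_univ_eq_sum_range (fun p => if m.length ≤ p then
      ∑ e : Equiv.Perm (Fin N), factorialR m N (y ∘ e) else 0) (N + 1), ← sum_filter, sum_const]
    have hcard : #((range (N + 1)).filter fun p => m.length ≤ p) = N - m.length + 1 := by
      have : (range (N + 1)).filter (fun p => m.length ≤ p) = Ico m.length (N + 1) := by
        ext a
        simp [and_comm]
      rw [this, Nat.card_Ico]
      omega
    rw [hcard, nsmul_eq_mul, show N + 1 - m.length = (N - m.length) + 1 by omega,
      Nat.factorial_succ]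
    have h3 : ((N - m.length).factorial : ℝ) ≠ 0 := by exact_mod_cast Nat.factorial_ne_zero _
    have h4 : ((N - m.length + 1 : ℕ) : ℝ) ≠ 0 := by
      exact_mod_cast Nat.succ_ne_zero (N - m.length)
    rw [Nat.cast_mul]
    field_simp

theorem dimWeight_snoc_zero {N : ℕ} (y : Fin N → ℕ) (hy : ∀ i, y i ≠ 0) :
    dimWeight (Fin.snoc (α := fun _ => ℕ) y 0 : Fin (N + 1) → ℕ) = dimWeight y := by
  unfold dimWeight
  congr 1
  · rw [Fin.prod_univ_castSucc]
    simp
  · rw [prod_filter, prod_filter, Fintype.prod_prod_type, Fintype.prod_prod_type,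
      Fin.prod_univ_castSucc]
    have h1 : ∀ j : Fin (N + 1), ¬ (Fin.last N < j) := fun j => not_lt.2 (Fin.le_last j)
    simp only [h1, if_false, prod_const_one, mul_one]
    refine prod_congr rfl fun i _ => ?_
    have h2 : (y i : ℝ) ≠ 0 := by exact_mod_cast hy i
    rw [Fin.prod_univ_castSucc]
    simp [h2]

/-! ### From functions of variables to functions of strict partitions -/

/-- `dimWeight` at the parts of a strict partition. -/
noncomputable def partWeight (l : StrictPartition) : ℝ := dimWeight fun i : Fin l.length => l.part i

theorem eq_snoc_part (l : StrictPartition) :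
    (fun i : Fin (l.length + 1) => l.part i) =
      Fin.snoc (α := fun _ => ℕ) (fun i : Fin l.length => l.part i) 0 := by
  ext i
  refine Fin.lastCases ?_ (fun j => ?_) i
  · rw [Fin.snoc_last]
    exact l.part_of_length_le le_rfl
  · rw [Fin.snoc_castSucc]
    rfl

/-- The case `N = l.length + 1` is met when a part 1 is lowered to 0: the length drops but the
number of variables does not. -/
theorem dimWeight_part_eq (l : StrictPartition) {N : ℕ} (hN : N = l.length ∨ N = l.length + 1) :
    dimWeight (fun i : Fin N => l.part i) = partWeight l := by
  rcases hN with rfl | rfl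
  · rfl
  · rw [eq_snoc_part, dimWeight_snoc_zero _ fun i => (l.part_pos i.2).ne', partWeight]

theorem factorialQ_part_eq (m l : StrictPartition) {N : ℕ}
    (hN : N = l.length ∨ N = l.length + 1) :
    factorialQ m N (fun i : Fin N => (l.part i : ℝ)) = factorialQFun m l := by
  rcases hN with rfl | rfl
  · rfl
  · have h : (fun i : Fin (l.length + 1) => (l.part i : ℝ)) =
        Fin.snoc (α := fun _ => ℝ) (fun i : Fin l.length => (l.part i : ℝ)) 0 := by
      ext i
      have h := congrFun (eq_snoc_part l) i
      rw [h]
      refine Fin.lastCases ?_ (fun j => ?_) i <;> simp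
    rw [h, factorialQ_snoc_zero _ _ fun i => by exact_mod_cast (l.part_pos i.2).ne', factorialQFun]

theorem part_injective (l : StrictPartition) :
    Function.Injective fun i : Fin l.length => l.part i :=
  fun i _ h => Fin.ext (part_inj (l.part_pos i.2) h)

theorem part_lower {l : StrictPartition} {i : ℕ} (hi : i < l.length)
    (h : l.CanLower (l.part i - 1)) (j : ℕ) :
    (l.lower (l.part i - 1)).part j = if j = i then l.part i - 1 else l.part j := by
  obtain ⟨b, hb, hc⟩ := h.exists_addBox
  obtain ⟨-, h2, h3⟩ := addBox_iff.1 hb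
  have hpos := l.part_pos hi
  have hbi : b.1 = i := by
    apply part_inj (l := l) <;> omega
  split_ifs with hj
  · subst hj
    rw [← hbi] at hc ⊢
    exact hc
  · rw [h3 j (by omega)]

/-- Decreasing the part in row `i` either removes a box or creates two equal variables, and in the
latter case the term vanishes by `h0`. By `h1`, a part that has become 0 may be dropped. -/
theorem sum_lower_eq_sum_update (Φ : ∀ N : ℕ, (Fin N → ℕ) → ℝ)
    (h0 : ∀ (N : ℕ) (y : Fin N → ℕ), ¬ Function.Injective y → Φ N y = 0)
    (h1 : ∀ (l : StrictPartition) (N : ℕ), N = l.length ∨ N = l.length + 1 →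
      Φ N (fun i => l.part i) = Φ l.length fun i => l.part i)
    (l : StrictPartition) {K : ℕ} (hK : l.weight ≤ K) :
    (∑ k ∈ range K, if l.CanLower k then
      Φ (l.lower k).length (fun i => (l.lower k).part i) else 0) =
    ∑ i : Fin l.length, Φ l.length
      (Function.update (fun i : Fin l.length => l.part i) i (l.part i - 1)) := by
  have hup : ∀ i : Fin l.length, l.CanLower (l.part i - 1) →
      Φ l.length (Function.update (fun i : Fin l.length => l.part i) i (l.part i - 1)) =
      Φ (l.lower (l.part i - 1)).length fun j => (l.lower (l.part i - 1)).part j := by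
    intro i h
    rw [← h1 _ l.length (by have := h.length_lower; split_ifs at this <;> omega)]
    congr 1
    ext j
    rw [part_lower i.2 h]
    simp only [Function.update_apply, Fin.ext_iff]
  have hcan : ∀ i : Fin l.length, Φ l.length
      (Function.update (fun i : Fin l.length => l.part i) i (l.part i - 1)) ≠ 0 →
      l.CanLower (l.part i - 1) := by
    intro i hne
    have hpos := l.part_pos i.2
    refine ⟨?_, fun hmem => ?_⟩
    · rw [Nat.sub_add_cancel hpos]
      exact part_mem_partSet i.2
    · obtain ⟨hp, j, hj⟩ := mem_partSet_iff.1 hmem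
      have hjl : j < l.length := lt_length_of_part_pos (by omega)
      have hji : (⟨j, hjl⟩ : Fin l.length) ≠ i := by
        rintro rfl
        simp only at hj hpos
        omega
      refine hne (h0 _ _ fun hinj => hji (hinj ?_))
      rw [Function.update_self, Function.update_of_ne hji, hj]
  rw [← sum_filter]
  symm
  refine sum_bij_ne_zero (fun i _ _ => l.part i - 1) ?_ ?_ ?_ ?_
  · intro i _ hne
    have := (hcan i hne).lt
    exact mem_filter.2 ⟨mem_range.2 (by omega), hcan i hne⟩
  · intro i _ _ j _ _ h
    have h1 := l.part_pos i.2
    have h2 := l.part_pos j.2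
    exact part_injective l (show l.part i = l.part j by omega)
  · intro k hk hne
    have hk' := (mem_filter.1 hk).2
    obtain ⟨-, i, hi⟩ := mem_partSet_iff.1 hk'.1
    have hil : i < l.length := lt_length_of_part_pos (by omega)
    have hki : l.part i - 1 = k := by omega
    subst hki
    refine ⟨⟨i, hil⟩, mem_univ _, ?_, rfl⟩
    rw [hup ⟨i, hil⟩ hk']
    exact hne
  · intro i _ hne
    exact hup i (hcan i hne)

theorem sum_partWeight_lower (l : StrictPartition) {K : ℕ} (hK : l.weight ≤ K) :
    (∑ k ∈ range K, if l.CanLower k then partWeight (l.lower k) else 0) =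
      (l.weight : ℝ) * partWeight l := by
  have h := sum_lower_eq_sum_update (fun _ y => dimWeight y) (fun _ => dimWeight_eq_zero)
    (fun l _ hN => dimWeight_part_eq l hN) l hK
  rw [partWeight, ← sum_part_eq_weight l le_rfl, Nat.cast_sum]
  exact h.trans (sum_dimWeight_update _ (part_injective l) fun i => l.part_pos i.2)

theorem sum_partWeight_mul_factorialQFun_lower (m l : StrictPartition) {K : ℕ}
    (hK : l.weight ≤ K) :
    (∑ k ∈ range K, if l.CanLower k then
      partWeight (l.lower k) * factorialQFun m (l.lower k) else 0) =
      ((l.weight : ℝ) - m.weight) * (partWeight l * factorialQFun m l) := by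
  have h := sum_lower_eq_sum_update (fun N y => dimWeight y * factorialQ m N fun i => (y i : ℝ))
    (fun _ y hy => by rw [dimWeight_eq_zero y hy, zero_mul])
    (fun l _ hN => by
      rw [dimWeight_part_eq l hN, factorialQ_part_eq m l hN]
      rfl) l hK
  rw [partWeight, ← sum_part_eq_weight l le_rfl, Nat.cast_sum]
  exact h.trans (sum_dimWeight_mul_factorialQ_update m _ (part_injective l) fun i => l.part_pos i.2)

theorem partWeight_pos (l : StrictPartition) : 0 < partWeight l := by
  unfold partWeight dimWeight
  refine mul_pos (prod_pos fun i _ => by positivity) (prod_pos fun p hp => ?_)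
  have h : l.part p.2 < l.part p.1 := l.part_lt_part (mem_filter.1 hp).2 p.2.2
  have h' : (l.part p.2 : ℝ) < l.part p.1 := by exact_mod_cast h
  exact div_pos (sub_pos.2 h') (by linarith [Nat.cast_nonneg (α := ℝ) (l.part p.2)])

/-- Either the length stays and the edge is double, or the length drops by one and the edge is
simple. Hence the factor $2^{\ell}$ makes all edges equivalent. -/
theorem two_pow_length_mul_contentMult {l : StrictPartition} {k : ℕ} (h : l.CanLower k) :
    (2 : ℝ) ^ l.length * contentMult k = 2 * 2 ^ (l.lower k).length := by
  rw [h.length_lower, contentMult]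
  split_ifs
  · rw [pow_succ]; ring
  · rw [add_zero]; ring

/-! ### The dimension formula, vanishing, and path counting by factorial Q-functions -/

theorem weight_empty : StrictPartition.empty.weight = 0 := rfl

theorem eq_empty_of_weight_eq_zero {l : StrictPartition} (h : l.weight = 0) :
    l = StrictPartition.empty := by
  have h1 : l.partSet = ∅ := by
    rw [eq_empty_iff_forall_notMem]
    intro a ha
    have := le_weight_of_mem_partSet ha
    exact l.zero_notMem_partSet ((show a = 0 by omega) ▸ ha)
  apply partSet_injective
  rw [h1]
  rfl

/-- The closed formula for the number of paths from the empty diagram. -/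
theorem two_pow_length_mul_dim (l : StrictPartition) :
    (2 : ℝ) ^ l.length * dim l = 2 ^ l.weight * (l.weight.factorial : ℝ) * partWeight l := by
  induction hn : l.weight generalizing l with
  | zero =>
    obtain rfl := eq_empty_of_weight_eq_zero hn
    rw [dim_eq_pathCount, pathCount_of_weight_eq rfl, if_pos rfl]
    have h : StrictPartition.empty.length = 0 := rfl
    have : IsEmpty (Fin StrictPartition.empty.length) := by rw [h]; infer_instance
    have hw : partWeight StrictPartition.empty = 1 := by
      simp [partWeight, dimWeight]
    rw [hw, h]
    simp
  | succ n ih =>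
    -- Both sides satisfy the same recursion over the diagrams covered by `l`.
    have hs := sum_partWeight_lower l (K := n + 1) (by omega)
    rw [hn] at hs
    rw [dim_eq_pathCount, pathCount_eq_sum (K := n + 1) (by rw [weight_empty]; omega) (by omega),
      Nat.factorial_succ, Nat.cast_mul]
    trans ∑ k ∈ range (n + 1), 2 * 2 ^ n * (n.factorial : ℝ) *
      (if l.CanLower k then partWeight (l.lower k) else 0)
    · rw [mul_sum]
      refine sum_congr rfl fun k _ => ?_
      split_ifs with h
      · have hw := h.weight_lower
        rw [← dim_eq_pathCount, ← mul_assoc, two_pow_length_mul_contentMult h, mul_assoc,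
          ih (l.lower k) (by omega)]
        ring
      · simp
    · rw [← mul_sum, hs]
      ring

theorem dim_pos (l : StrictPartition) : (0 : ℝ) < dim l := by
  have h := two_pow_length_mul_dim l
  have h1 : (0 : ℝ) < 2 ^ l.weight * (l.weight.factorial : ℝ) * partWeight l :=
    mul_pos (by positivity) (partWeight_pos l)
  rw [← h] at h1
  exact pos_of_mul_pos_right h1 (by positivity)

/-- A nonzero term requires `m_i ≤ l_{w(i)}` for every `i`, since $a^{\downarrow k}=0$ for integers
$0\le a<k$. Summation over `i` and `|l| ≤ |m|` force equality everywhere. -/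
theorem part_eq_of_factorialR_ne_zero (m l : StrictPartition) (hw : l.weight ≤ m.weight)
    (hN : m.length ≤ l.length) (w : Equiv.Perm (Fin l.length))
    (h : factorialR m l.length ((fun i : Fin l.length => (l.part i : ℝ)) ∘ w) ≠ 0) :
    m = l ∧ ∀ i, l.part (w i) = m.part i := by
  have hle : ∀ i : Fin l.length, m.part i ≤ l.part (w i) := by
    intro i
    by_cases hi : i.val < m.length
    · by_contra hlt
      apply h
      apply mul_eq_zero_of_left
      refine prod_eq_zero (i := i) (by simp [hi]) ?_
      rw [Function.comp_apply, descPochhammer_eval_eq_descFactorial,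
        Nat.descFactorial_eq_zero_iff_lt.2 (not_le.1 hlt), Nat.cast_zero]
    · rw [m.part_of_length_le (not_lt.1 hi)]
      exact Nat.zero_le _
  have hsum : ∑ i : Fin l.length, l.part (w i) = l.weight :=
    (Equiv.sum_comp w fun i => l.part i).trans (sum_part_eq_weight l le_rfl)
  have hsum' := sum_part_eq_weight m hN
  have heq : ∀ i : Fin l.length, m.part i = l.part (w i) := by
    have h1 := (sum_eq_sum_iff_of_le (s := univ) fun i _ => hle i).1
      (le_antisymm (sum_le_sum fun i _ => hle i) (by rw [hsum, hsum']; exact hw))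
    exact fun i => h1 i (mem_univ i)
  refine ⟨?_, fun i => (heq i).symm⟩
  apply partSet_injective
  ext a
  rw [mem_partSet_iff, mem_partSet_iff]
  refine and_congr_right fun ha => ⟨?_, ?_⟩
  · rintro ⟨i, rfl⟩
    have hi := (lt_length_of_part_pos ha).trans_le hN
    exact ⟨w ⟨i, hi⟩, (heq ⟨i, hi⟩).symm⟩
  · rintro ⟨i, rfl⟩
    have hi := lt_length_of_part_pos ha
    refine ⟨w.symm ⟨i, hi⟩, ?_⟩
    rw [heq, Equiv.apply_symm_apply]

theorem factorialQFun_eq_zero {m l : StrictPartition} (hw : l.weight ≤ m.weight) (hne : m ≠ l) :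
    factorialQFun m l = 0 := by
  unfold factorialQFun factorialQ
  split_ifs with hN
  · apply mul_eq_zero_of_right
    refine sum_eq_zero fun w _ => ?_
    by_contra h
    exact hne (part_eq_of_factorialR_ne_zero m l hw hN w h).1
  · rfl

/-- Only the identity permutation contributes. In its regular form the term is a product of the
ratios $m_i^{\downarrow m_i}/m_i!=1$, with no pairs left. -/
theorem partWeight_mul_factorialQFun_self (m : StrictPartition) :
    partWeight m * factorialQFun m m = 2 ^ m.length := by
  unfold factorialQFun factorialQ
  rw [if_pos le_rfl, sum_eq_single_of_mem (1 : Equiv.Perm (Fin m.length)) (mem_univ _)]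
  · have h := dimWeight_mul_factorialR m (fun i : Fin m.length => m.part i) (part_injective m)
    have h1 : regularTerm m (fun i : Fin m.length => m.part i) = 1 := by
      unfold regularTerm
      rw [filter_false_of_mem (fun p _ h => h.2 p.1.2), prod_empty, mul_one]
      refine prod_eq_one fun i _ => ?_
      rw [if_pos i.2, descPochhammer_eval_eq_descFactorial, Nat.descFactorial_self, div_self]
      exact_mod_cast Nat.factorial_ne_zero _
    rw [h1] at h
    rw [Nat.sub_self, Nat.factorial_zero, Nat.cast_one, div_one, mul_left_comm]
    exact (congrArg _ h).trans (mul_one _)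
  · intro w _ hw
    by_contra h
    apply hw
    ext i
    have := (part_eq_of_factorialR_ne_zero m m le_rfl le_rfl w h).2 i
    exact part_inj (m.part_pos (w i).2) this

/-- The factorial Schur Q-functions count paths in the Schur graph. -/
theorem factorialQFun_mul_dim (m l : StrictPartition) :
    factorialQFun m l * dim l =
      2 ^ m.weight * (l.weight.descFactorial m.weight : ℝ) * pathCount m l := by
  rcases Nat.lt_or_ge l.weight m.weight with hlt | hge
  · rw [pathCount_of_weight_lt hlt, factorialQFun_eq_zero hlt.le (by rintro rfl; omega)]
    simp
  induction hn : l.weight using Nat.strong_induction_on generalizing l with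
  | _ n ih =>
  subst hn
  have h2 : (2 : ℝ) ^ l.length ≠ 0 := by positivity
  rcases hge.eq_or_lt with heq | hlt
  · rw [pathCount_of_weight_eq heq.symm]
    split_ifs with h
    · subst h
      apply mul_left_cancel₀ h2
      rw [mul_left_comm, two_pow_length_mul_dim, Nat.descFactorial_self,
        ← partWeight_mul_factorialQFun_self m]
      ring
    · rw [factorialQFun_eq_zero heq.symm.le h]
      simp
  -- For `|l| > |m|` the recursion for `partWeight l * factorialQFun m l` determines the value after
  -- division by `|l| - |m|`. It matches the recursion for path counts through
  -- $(|l|-|m|)\,|l|^{\downarrow|m|}=|l|\,(|l|-1)^{\downarrow|m|}$.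
  · obtain ⟨n, hn⟩ := Nat.exists_eq_succ_of_ne_zero (show l.weight ≠ 0 by omega)
    have hs := sum_partWeight_mul_factorialQFun_lower m l le_rfl
    have hd : ((l.weight : ℝ) - m.weight) ≠ 0 := sub_ne_zero.2 (by exact_mod_cast hlt.ne')
    apply mul_left_cancel₀ h2
    apply mul_left_cancel₀ hd
    rw [pathCount_eq_sum hlt le_rfl]
    have hdesc : ((l.weight : ℝ) - m.weight) * (l.weight.descFactorial m.weight : ℝ) =
        l.weight * (n.descFactorial m.weight : ℝ) := by
      have h3 := Nat.descFactorial_succ l.weight m.weight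
      have h4 := Nat.succ_descFactorial_succ n m.weight
      rw [← Nat.succ_eq_add_one, ← hn] at h4
      rw [h4] at h3
      have h5 := congrArg (Nat.cast (R := ℝ)) h3
      rw [Nat.cast_mul, Nat.cast_mul, Nat.cast_sub hlt.le] at h5
      exact h5.symm
    trans (2 * 2 ^ n * (n.factorial : ℝ)) * l.weight *
      ∑ k ∈ range l.weight, if l.CanLower k then
        partWeight (l.lower k) * factorialQFun m (l.lower k) else 0
    · rw [hs, mul_left_comm (2 ^ l.length), two_pow_length_mul_dim, hn, Nat.factorial_succ,
        Nat.succ_eq_add_one, pow_succ]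
      push_cast
      ring
    · trans 2 ^ m.weight * (l.weight * (n.descFactorial m.weight : ℝ)) * (2 ^ l.length *
        ∑ k ∈ range l.weight, if l.CanLower k then
          contentMult k * pathCount m (l.lower k) else 0)
      · rw [mul_sum, mul_sum, mul_sum]
        refine sum_congr rfl fun k _ => ?_
        split_ifs with h
        · have hw := h.weight_lower
          have hw' : (l.lower k).weight = n := by omega
          have h5 := ih (l.lower k).weight (by omega) (l.lower k) (by omega) rfl
          have h6 := two_pow_length_mul_dim (l.lower k)
          have h7 := two_pow_length_mul_contentMult h
          rw [hw'] at h5 h6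
          linear_combination (-2 * (l.weight : ℝ) * factorialQFun m (l.lower k)) * h6 +
            (2 * (l.weight : ℝ) * 2 ^ (l.lower k).length) * h5 -
            (2 ^ m.weight * (l.weight * (n.descFactorial m.weight : ℝ)) *
              pathCount m (l.lower k)) * h7
        · simp
      · rw [← hdesc]
        ring

end SchurGraph

/-! ### The up/down operator on factorial Q-functions -/

namespace SchurGraph
open StrictPartition

theorem content_nonneg_of_mem_boxes {l : StrictPartition} {b : ℕ × ℕ} (hb : b ∈ l.boxes) :
    0 ≤ content b := by
  have := ((l.mem_boxes b).1 hb).1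
  simp only [content]
  omega

theorem downProb_eq_zero {m l : StrictPartition} (h : ¬ m.Covers l) : downProb l m = 0 := by
  rw [downProb, edgeMult_eq_zero h, Nat.cast_zero, mul_zero]

/-- The explicit form of the up transition function of the multiplicative measures. -/
theorem upProb_multMeasure_raise {α : ℝ} (hα : 0 < α) {l : StrictPartition} {k : ℕ}
    (h : l.CanRaise k) :
    upProb (multMeasure α) l (l.raise k) =
      dim (l.raise k) / dim l * (boxWeight α k / (((l.weight : ℝ) + 1) * (α + 2 * l.weight))) := by
  obtain ⟨b, hb, hc⟩ := addBox_content_iff_raise.2 ⟨h, rfl⟩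
  have hbox : ∏ b ∈ (l.raise k).boxes, ((content b : ℝ) * ((content b : ℝ) + 1) + α) =
      boxWeight α k * ∏ b ∈ l.boxes, ((content b : ℝ) * ((content b : ℝ) + 1) + α) := by
    rw [hb.2, prod_insert hb.1, hc, boxWeight, Int.cast_natCast]
  have hC : ∏ b ∈ l.boxes, ((content b : ℝ) * ((content b : ℝ) + 1) + α) ≠ 0 := by
    refine (prod_pos fun b hb => ?_).ne'
    have : (0 : ℝ) ≤ content b := by exact_mod_cast content_nonneg_of_mem_boxes hb
    positivity
  have hP : ∏ j ∈ range l.weight, (α + 2 * (j : ℝ)) ≠ 0 :=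
    (prod_pos fun j _ => by positivity).ne'
  have hpow := two_pow_length_mul_contentMult h.canLower_raise
  rw [h.lower_raise] at hpow
  have hd := (dim_pos l).ne'
  have hd' := (dim_pos (l.raise k)).ne'
  have hf : (l.weight.factorial : ℝ) ≠ 0 := by exact_mod_cast Nat.factorial_ne_zero _
  have hn : (l.weight : ℝ) + 1 ≠ 0 := by positivity
  have hα' : α + 2 * (l.weight : ℝ) ≠ 0 := by positivity
  rw [upProb, downProb, CanRaise.edgeMult_eq h, multMeasure, multMeasure, plancherel, plancherel,
    hbox, h.weight_raise, prod_range_succ, Nat.factorial_succ, zpow_sub₀ two_ne_zero,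
    zpow_sub₀ two_ne_zero, zpow_natCast, zpow_natCast, zpow_natCast, zpow_natCast, pow_succ]
  push_cast
  generalize ∏ b ∈ l.boxes, ((content b : ℝ) * ((content b : ℝ) + 1) + α) = C at *
  generalize ∏ j ∈ range l.weight, (α + 2 * (j : ℝ)) = P at *
  generalize boxWeight α k = W at *
  field_simp
  linear_combination (W * 2 ^ l.weight) * hpow

/-- The down operator on factorial Schur Q-functions. -/
theorem sum_downProb_mul_factorialQFun (m v : StrictPartition) {n : ℕ} (hv : v.weight = n + 1) :
    ∑ l : StrictPartitionOf n, downProb v l.1 * factorialQFun m l.1 =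
      2 ^ m.weight * (n.descFactorial m.weight : ℝ) * pathCount m v / dim v := by
  have h1 : ∑ l : StrictPartitionOf n, downProb v l.1 * factorialQFun m l.1 =
      (∑ l : StrictPartitionOf n, (factorialQFun m l.1 * dim l.1) * edgeMult l.1 v) / dim v := by
    rw [sum_div]
    refine sum_congr rfl fun l _ => ?_
    rw [downProb]
    ring
  rw [h1, sum_mul_edgeMult hv (Nat.lt_succ_self n) (fun l => factorialQFun m l * dim l)]
  congr 1
  have h2 : (∑ k ∈ range (n + 1), if v.CanLower k then
      contentMult k * (factorialQFun m (v.lower k) * dim (v.lower k)) else 0) =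
      2 ^ m.weight * (n.descFactorial m.weight : ℝ) *
        ∑ k ∈ range (n + 1), if v.CanLower k then contentMult k * pathCount m (v.lower k)
          else 0 := by
    rw [mul_sum]
    refine sum_congr rfl fun k _ => ?_
    split_ifs with h
    · have hw := h.weight_lower
      rw [factorialQFun_mul_dim, show (v.lower k).weight = n by omega]
      ring
    · simp
  refine h2.trans ?_
  -- For `n < |m|` the path recursion may fail (`v = m` has no shorter path), but the falling
  -- factorial is zero.
  rcases Nat.lt_or_ge n m.weight with hlt | hge
  · rw [Nat.descFactorial_of_lt hlt]
    simp
  · rw [← pathCount_eq_sum (by omega) (by omega)]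

/-- The real difference replaces truncated subtraction: when it is negative, the falling factorial
is already zero. -/
theorem cast_descFactorial_succ (n k : ℕ) :
    (n.descFactorial (k + 1) : ℝ) = ((n : ℝ) - k) * n.descFactorial k := by
  rw [Nat.descFactorial_succ, Nat.cast_mul]
  rcases Nat.lt_or_ge n k with h | h
  · rw [Nat.descFactorial_of_lt h]
    simp
  · rw [Nat.cast_sub h]

theorem transitionOp_factorialQFun {α : ℝ} (hα : 0 < α) (m : StrictPartition) {n K : ℕ}
    (hK : n + 1 < K) (l : StrictPartitionOf n) :
    transitionOp α n (restrict n (factorialQFun m)) l =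
      2 ^ m.weight * (n.descFactorial m.weight : ℝ) / dim l.1 /
        (((n : ℝ) + 1) * (α + 2 * n)) *
      ((∑ j ∈ range K, if m.CanLower j then boxWeight α j * pathCount (m.lower j) l.1 else 0) +
        ((n : ℝ) - m.weight + 1) * (α + 2 * ((n : ℝ) + m.weight)) * pathCount m l.1) := by
  have hl : l.1.weight = n := l.2
  have h1 : transitionOp α n (restrict n (factorialQFun m)) l =
      ∑ v : StrictPartitionOf (n + 1), upProb (multMeasure α) l.1 v.1 *
        (2 ^ m.weight * (n.descFactorial m.weight : ℝ) * pathCount m v.1 / dim v.1) := by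
    simp only [transitionOp, Matrix.mulVecLin_apply, Matrix.mulVec, dotProduct, transitionMatrix,
      Matrix.of_apply, restrict, sum_mul]
    rw [sum_comm]
    refine sum_congr rfl fun v _ => ?_
    rw [← sum_downProb_mul_factorialQFun m v.1 v.2, mul_sum]
    exact sum_congr rfl fun l' _ => mul_assoc _ _ _
  have h2 := sum_covers_above hl (show n < K by omega) (fun v => upProb (multMeasure α) l.1 v *
        (2 ^ m.weight * (n.descFactorial m.weight : ℝ) * pathCount m v / dim v))
    (fun v hv => by rw [upProb, downProb_eq_zero hv]; simp)
  rw [h1, h2]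
  trans 2 ^ m.weight * (n.descFactorial m.weight : ℝ) / dim l.1 /
        (((n : ℝ) + 1) * (α + 2 * n)) *
      ∑ j ∈ range K, if l.1.CanRaise j then boxWeight α j * pathCount m (l.1.raise j) else 0
  · rw [mul_sum]
    refine sum_congr rfl fun k _ => ?_
    split_ifs with h
    · have hd := (dim_pos l.1).ne'
      have hd' := (dim_pos (l.1.raise k)).ne'
      have hn : (n : ℝ) + 1 ≠ 0 := by positivity
      have hα' : α + 2 * (n : ℝ) ≠ 0 := by positivity
      rw [upProb_multMeasure_raise hα h, hl]
      field_simp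
    · simp
  -- For `n < |m|` both sides vanish by the prefactor, so the bound `|m| ≤ |l| + 1` of the path
  -- identity is needed only in the other case.
  · rcases Nat.lt_or_ge n m.weight with hlt | hge
    · rw [Nat.descFactorial_of_lt hlt]
      simp
    · rw [sum_boxWeight_mul_pathCount α m (K := K) l.1 (by omega) (by omega), hl]

end SchurGraph

end

open Finset SchurGraph in
theorem theorem2p7 (α : ℝ) (hα : 0 < α) (n : ℕ) (hn : 0 < n) (μ : StrictPartition) :
    (SchurGraph.transitionOp α n - 1) (SchurGraph.restrict n (SchurGraph.factorialQFun μ)) =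
      (1 / (((n : ℝ) + 1) * ((n : ℝ) + α / 2))) •
        (-((μ.weight : ℝ) * ((μ.weight : ℝ) + α / 2 - 1)) •
            SchurGraph.restrict n (SchurGraph.factorialQFun μ) +
          ((n : ℝ) - (μ.weight : ℝ) + 1) •
            ∑ y ∈ μ.removableContents,
              ((y : ℝ) * ((y : ℝ) + 1) + α) •
                SchurGraph.restrict n (SchurGraph.factorialQFun (μ.removeBox y))) := by
  funext l
  have hl : l.1.weight = n := l.2
  -- Large enough to contain all contents that occur for `μ` and for the diagrams of weight `n` and
  -- `n + 1`.
  set K := n + μ.weight + 2 with hK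
  rw [StrictPartition.sum_removableContents (K := K) (by omega) (fun y ρ =>
    ((y : ℝ) * ((y : ℝ) + 1) + α) • restrict n (factorialQFun ρ))]
  have hd := (dim_pos l.1).ne'
  have hQ : ∀ m : StrictPartition, factorialQFun m l.1 =
      2 ^ m.weight * (n.descFactorial m.weight : ℝ) * pathCount m l.1 / dim l.1 := by
    intro m
    rw [eq_div_iff hd, factorialQFun_mul_dim, hl]
  -- The coefficient `n - |μ| + 1` raises the falling factorial of `μ - □` to that of `μ`, and the
  -- division by 2 compensates for $2^{|\mu|-1}$.
  have hsum : ((n : ℝ) - (μ.weight : ℝ) + 1) * (∑ k ∈ range K, if μ.CanLower k then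
      (((k : ℤ) : ℝ) * (((k : ℤ) : ℝ) + 1) + α) • restrict n (factorialQFun (μ.lower k)) else 0)
        l =
      2 ^ μ.weight * (n.descFactorial μ.weight : ℝ) / dim l.1 / 2 *
        ∑ j ∈ range K, if μ.CanLower j then boxWeight α j * pathCount (μ.lower j) l.1 else 0 := by
    rw [Finset.sum_apply, mul_sum, mul_sum]
    refine sum_congr rfl fun k _ => ?_
    split_ifs with h
    · have hw := h.weight_lower
      have hw' : (μ.weight : ℝ) = (μ.lower k).weight + 1 := by exact_mod_cast hw.symm
      simp only [Pi.smul_apply, SchurGraph.restrict, smul_eq_mul]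
      rw [hQ, hw', ← hw, cast_descFactorial_succ, pow_succ, boxWeight, Int.cast_natCast]
      ring
    · simp
  simp only [LinearMap.sub_apply, Module.End.one_apply, Pi.sub_apply, Pi.smul_apply, Pi.add_apply,
    smul_eq_mul]
  rw [hsum, transitionOp_factorialQFun hα μ (K := K) (by omega)]
  simp only [SchurGraph.restrict]
  rw [hQ μ]
  have hn1 : (n : ℝ) + 1 ≠ 0 := by positivity
  have hn2 : (n : ℝ) + α / 2 ≠ 0 := by positivity
  have hn3 : α + 2 * (n : ℝ) ≠ 0 := by positivity
  have hn4 : (n : ℝ) * 2 + α ≠ 0 := by positivity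
  -- With `m = |μ|`, the remaining identity is `(n - m + 1)(α + 2n + 2m) - (n + 1)(α + 2n) = -2m(m +
  -- α/2 - 1)`.
  field_simp
  ring
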